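/- Let $K$ be a number field, let $\alpha,\beta\in K$ be nonzero, and assume that the quaternion algebra $A=\left(\frac{\alpha,\beta}{K}\right)$, with $i^2=\alpha$, $j^2=\beta$, $ij=k=-ji$, is a division algebra. In $A[x]$ the variable $x$ commutes with the coefficients; $\overline f$ is obtained from $f\in A[x]$ by applying the standard involution to every coefficient, $N(f)=f\overline f\in K[x]$ is the norm, $\mathrm{lc}(f)$ is the leading coefficient, and $\mathrm{gcrd}(f,g)$ is the monic greatest common right divisor. For an extension $L/K$ write $A_L=\left(\frac{\alpha,\beta}{L}\right)$ for the extension of scalars; $A$ splits over $L$ if $A_L\cong M_2(L)$ as $L$-algebras. Consider the following algorithms. They use exact arithmetic, factorization of polynomials over number fields, the construction of quadratic subfields, tests for splitting, and the construction of embeddings and zero-divisors as subroutines; wherever an object is to be found, any object with the stated property may be used. **Subfield algorithm** (input: $p\in K[x]$ monic irreducible). List all subfields $L_1,\dots,L_n$ of $K[x]/(p)$ that have degree $2$ over $K$. Go through them in order, skipping those over which $A$ does not split. For the first $L_i$ over which $A$ splits, find a $K$-embedding $\varphi:L_i\to A$, factor $p=f\overline f$ with $f$ monic with coefficients in $\varphi(L_i)$,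 output $(f,\overline f)$ and stop. If there is none, report a failure. **Central algorithm** (input: $p\in K[x]$ monic irreducible). Let $L=K[x]/(p)$. 1. If $A$ does not split over $L$, output $(p)$ and stop. 2. Otherwise run the subfield algorithm on $p$; if it returns $(f,\overline f)$, output $(f,\overline f)$ and stop. 3. Otherwise find a nonzero zero-divisor $a\in A_L$, let $f\in A[x]$ be its lift whose four coordinates with respect to $1,i,j,k$ have degree less than $\deg p$, and set $q:=f\overline f/p$. 4. While $q$ is non-constant: let $r$ be the remainder of $f$ modulo $q$, replace $f$ by $f\overline r/q$, and then $q$ by $f\overline f/p$. 5. With $c:=\mathrm{lc}(f)$, output $(f c^{-1},\ \overline c^{\,-1}\overline f)$. **Complete factorization algorithm** (input: $f\in A[x]$ nonzero). 1. Let $c:=\mathrm{lc}(f)$, replace $f$ by $c^{-1}f$, and let $\mathcal L:=()$. 2. Let $p\in K[x]$ be the monic greatest common divisor of the four coordinates of $f$ with respect to the $K[x]$-basis $1,i,j,k$ of $A[x]$ (the maximal central factor of $f$), and let $q:=f p^{-1}$. 3. Factor $p=r_1^{e_1}\cdots r_m^{e_m}$ in $K[x]$ with distinct monic irreducible $r_i$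 and $e_i\ge 1$. For each $i$, run the central algorithm on $r_i$ and append $e_i$ copies of its output to $\mathcal L$. 4. Factor $N(q)=q_1^{\varepsilon_1}\cdots q_k^{\varepsilon_k}$ in $K[x]$ with distinct monic irreducible $q_i$ and $\varepsilon_i\ge 1$. 5. While $q$ is non-constant: let $r:=\mathrm{gcrd}(q,q_k)$, prepend $r$ to $\mathcal L$, replace $q$ by $q r^{-1}$, decrease $\varepsilon_k$ by $1$, and if now $\varepsilon_k=0$, decrease $k$ by $1$. 6. Output $c$ and $\mathcal L$. **Theorem.** Let $f\in A[x]$ be nonzero. - There are monic irreducible $q_1,\dots,q_n\in A[x]$ ($n\ge 0$) such that $f=\mathrm{lc}(f)\cdot q_1\cdots q_n$. - The complete factorization algorithm, run on the input $f$, computes such a factorization: every run, including the runs of the two subroutines, is finite; no step of a run is ever blocked, that is, every division that is asked for is exact and every object to be found exists; hence an output is produced; and whatever is output is $c=\mathrm{lc}(f)$ together with a list $(q_1,\dots,q_n)$ of monic irreducible polynomials of $A[x]$ such that $f=c\cdot q_1\cdots q_n$. -/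

import Mathlib

open scoped Quaternion Polynomial

noncomputable section

namespace QuatFactor

/-- A ring (here: a quaternion algebra) is a division algebra. -/
def IsDivision (R : Type*) [Ring R] : Prop :=
  Nontrivial R ∧ ∀ a : R, a ≠ 0 → IsUnit a

/-! ### Quaternionic polynomials -/

section Polynomials

variable {K : Type*} [Field K] {α β : K}

/-- The inclusion of `K[x]` into the ring of quaternionic polynomials. -/
def central (α β : K) (p : K[X]) : ℍ[K,α,β][X] :=
  p.map (algebraMap K ℍ[K,α,β])

/-- Conjugation of quaternionic polynomials: the standard involution is applied to every
coefficient. The norm of `f` is `f * conj f`. -/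
def conj (f : ℍ[K,α,β][X]) : ℍ[K,α,β][X] :=
  f.sum fun n a => Polynomial.monomial n (star a)

/-- The polynomial over `K` whose coefficients are the images under `φ` of those of `f`. For
`φ` one of the four coordinate functions this is the corresponding coordinate of `f` with
respect to the `K[x]`-basis `1, i, j, k`. -/
def coord (φ : ℍ[K,α,β] →ₗ[K] K) (f : ℍ[K,α,β][X]) : K[X] :=
  f.sum fun n a => Polynomial.monomial n (φ a)

/-- The coordinates of `f` with respect to the basis `1, i, j, k`. -/
def coords (f : ℍ[K,α,β][X]) : List K[X] :=
  [coord (QuaternionAlgebra.reₗ α 0 β) f, coord (QuaternionAlgebra.imIₗ α 0 β) f,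
    coord (QuaternionAlgebra.imJₗ α 0 β) f, coord (QuaternionAlgebra.imKₗ α 0 β) f]

/-- `d` is the monic greatest common divisor in `K[x]` of the members of the list `l`. -/
def IsMonicGcd (l : List K[X]) (d : K[X]) : Prop :=
  d.Monic ∧ (∀ f ∈ l, d ∣ f) ∧ ∀ e : K[X], (∀ f ∈ l, e ∣ f) → e ∣ d

/-- `d` is a right divisor of `f`. -/
def RightDvd (d f : ℍ[K,α,β][X]) : Prop := ∃ h, f = h * d

/-- `d` is the monic greatest common right divisor of `f` and `g`. -/
def IsGcrd (f g d : ℍ[K,α,β][X]) : Prop :=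
  d.Monic ∧ RightDvd d f ∧ RightDvd d g ∧ ∀ e, RightDvd e f → RightDvd e g → RightDvd e d

/-- `l = [(r₁, e₁), …, (rₘ, eₘ)]` is the factorization `f = r₁ ^ e₁ ⋯ rₘ ^ eₘ` of the monic
polynomial `f` into powers of distinct monic irreducible polynomials over `K`. -/
def IsFactorization (f : K[X]) (l : List (K[X] × ℕ)) : Prop :=
  (l.map Prod.fst).Nodup ∧ (∀ t ∈ l, t.1.Monic ∧ Irreducible t.1 ∧ 0 < t.2) ∧
    (l.map fun t => t.1 ^ t.2).prod = f

end Polynomials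

/-! ### Extension of scalars -/

section BaseChange

variable {K : Type*} [Field K]

/-- The extension of scalars `(α, β)_L` of the quaternion algebra `(α, β)_K`. -/
abbrev BaseChange (α β : K) (L : Type*) [CommRing L] [Algebra K L] : Type _ :=
  ℍ[L,algebraMap K L α,algebraMap K L β]

/-- The quaternion algebra `(α, β)_K` splits over `L`. -/
def SplitsOver (α β : K) (L : Type*) [CommRing L] [Algebra K L] : Prop :=
  Nonempty (BaseChange α β L ≃ₐ[L] Matrix (Fin 2) (Fin 2) L)

/-- The natural homomorphism from quaternionic polynomials onto the quaternion algebra over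
`K[x]/(p)`: every coordinate is reduced modulo `p`. -/
def reduce {α β : K} (p : K[X]) (f : ℍ[K,α,β][X]) : BaseChange α β (AdjoinRoot p) :=
  ⟨AdjoinRoot.mk p (coord (QuaternionAlgebra.reₗ α 0 β) f),
    AdjoinRoot.mk p (coord (QuaternionAlgebra.imIₗ α 0 β) f),
    AdjoinRoot.mk p (coord (QuaternionAlgebra.imJₗ α 0 β) f),
    AdjoinRoot.mk p (coord (QuaternionAlgebra.imKₗ α 0 β) f)⟩

/-- A nonzero element that is a left or a right zero-divisor. -/
def IsZeroDivisor {R : Type*} [Ring R] (a : R) : Prop :=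
  a ≠ 0 ∧ ∃ b : R, b ≠ 0 ∧ (a * b = 0 ∨ b * a = 0)

/-- `S` is a subfield of `L` that contains `K` and has degree `2` over `K`. -/
def IsQuadraticSubfield {L : Type*} [CommRing L] [Algebra K L] (S : Subalgebra K L) : Prop :=
  IsField S ∧ Module.finrank K S = 2

end BaseChange

/-! ### The algorithms

Each algorithm is a transition system. A state records the position in the algorithm together
with the current values of its variables, and one transition executes one step. A step that asks
to find, construct or factor something may continue with any object that has the required
property; such a step is blocked if there is no such object. -/

section Algorithms

variable {K : Type*} [Field K]

/-- States of the subfield algorithm for the input `p`. In `loop todo` the list `todo` holds the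
quadratic subfields of `K[x]/(p)` that remain to be examined. -/
inductive SubfieldState (α β : K) (p : K[X]) : Type _
  | start
  | loop (todo : List (Subalgebra K (AdjoinRoot p)))
  | success (f g : ℍ[K,α,β][X])
  | failure

/-- The steps of the subfield algorithm, which looks for a factorization of `p` over a maximal
commutative subfield of the quaternion algebra. -/
inductive SubfieldStep (α β : K) (p : K[X]) :
    SubfieldState α β p → SubfieldState α β p → Prop
  /-- Construct all quadratic subfields of `K[x]/(p)`. -/
  | construct (todo : List (Subalgebra K (AdjoinRoot p))) (hnodup : todo.Nodup)
      (hall : ∀ S, S ∈ todo ↔ IsQuadraticSubfield S) :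
      SubfieldStep α β p .start (.loop todo)
  /-- The quaternion algebra does not split over the subfield `S`: go on to the next one. -/
  | skip (S : Subalgebra K (AdjoinRoot p)) (rest : List (Subalgebra K (AdjoinRoot p)))
      (hS : ¬ SplitsOver α β S) :
      SubfieldStep α β p (.loop (S :: rest)) (.loop rest)
  /-- The quaternion algebra splits over `S`: find an embedding `φ` of `S` into it, factor `p`
  over the image of `φ` as `f * conj f`, and output these two factors. -/
  | factor (S : Subalgebra K (AdjoinRoot p)) (rest : List (Subalgebra K (AdjoinRoot p)))
      (hS : SplitsOver α β S) (φ : S →ₐ[K] ℍ[K,α,β]) (f : ℍ[K,α,β][X]) (hmonic : f.Monic)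
      (hcoeff : ∀ n, f.coeff n ∈ φ.range) (hf : central α β p = f * conj f) :
      SubfieldStep α β p (.loop (S :: rest)) (.success f (conj f))
  /-- All subfields have been examined: report a failure. -/
  | report : SubfieldStep α β p (.loop []) .failure

/-- States of the algorithm that factors a monic irreducible `p ∈ K[x]` over the quaternion
algebra. In `loop f q` the variables satisfy `p * q = f * conj f`. -/
inductive ScalarState (α β : K) (p : K[X]) : Type _
  | start
  | subfield (s : SubfieldState α β p)
  | loop (f : ℍ[K,α,β][X]) (q : K[X])
  | output (l : List ℍ[K,α,β][X])

/-- The steps of the algorithm that factors a monic irreducible `p ∈ K[x]` over the quaternion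
algebra. -/
inductive ScalarStep (α β : K) (p : K[X]) : ScalarState α β p → ScalarState α β p → Prop
  /-- The algebra does not split over `K[x]/(p)`: output `p`. -/
  | quickExit (h : ¬ SplitsOver α β (AdjoinRoot p)) :
      ScalarStep α β p .start (.output [central α β p])
  /-- The algebra splits over `K[x]/(p)`: execute the subfield algorithm. -/
  | callSubfield (h : SplitsOver α β (AdjoinRoot p)) :
      ScalarStep α β p .start (.subfield .start)
  | inSubfield (s t : SubfieldState α β p) (h : SubfieldStep α β p s t) :
      ScalarStep α β p (.subfield s) (.subfield t)
  /-- The subfield algorithm has found a factorization: output it. -/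
  | subfieldSuccess (f g : ℍ[K,α,β][X]) :
      ScalarStep α β p (.subfield (.success f g)) (.output [f, g])
  /-- The subfield algorithm has failed: find a zero-divisor `a`, lift it to the quaternionic
  polynomial `f` with reduced coordinates, and set `q := f * conj f / p`. -/
  | zeroDivisor (a : BaseChange α β (AdjoinRoot p)) (ha : IsZeroDivisor a)
      (f : ℍ[K,α,β][X]) (hf : reduce p f = a) (hdeg : f.degree < p.degree)
      (q : K[X]) (hq : central α β (p * q) = f * conj f) :
      ScalarStep α β p (.subfield .failure) (.loop f q)
  /-- While `q` is non-constant: let `r` be the remainder of `f` modulo `q` and replace `f` by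
  `f * conj r / q` and then `q` by `f * conj f / p`. -/
  | improve (f : ℍ[K,α,β][X]) (q : K[X]) (hconst : 0 < q.natDegree)
      (h r : ℍ[K,α,β][X]) (hr : f = h * central α β q + r) (hdeg : r.degree < q.degree)
      (f' : ℍ[K,α,β][X]) (hf' : f' * central α β q = f * conj r)
      (q' : K[X]) (hq' : central α β (p * q') = f' * conj f') :
      ScalarStep α β p (.loop f q) (.loop f' q')
  /-- Once `q` is constant: let `c` be the leading coefficient of `f` and output `f * c⁻¹` and
  `(star c)⁻¹ * conj f`. -/
  | finish (f : ℍ[K,α,β][X]) (q : K[X]) (hconst : q.natDegree = 0) :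
      ScalarStep α β p (.loop f q)
        (.output [f * Polynomial.C (Ring.inverse f.leadingCoeff),
          Polynomial.C (Ring.inverse (star f.leadingCoeff)) * conj f])

/-- States of the complete factorization algorithm. The variables are the leading coefficient
`c`, the list `L` of factors found so far, and the polynomial `q` that is still to be factored. -/
inductive State (α β : K) : Type _
  /-- The input is `f`. -/
  | start (f : ℍ[K,α,β][X])
  /-- `f` is the input divided by its leading coefficient `c`. -/
  | monic (c : ℍ[K,α,β]) (L : List ℍ[K,α,β][X]) (f : ℍ[K,α,β][X])
  /-- The maximal central factor `p` has been split off. -/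
  | split (c : ℍ[K,α,β]) (L : List ℍ[K,α,β][X]) (q : ℍ[K,α,β][X]) (p : K[X])
  /-- `todo` holds the powers `r ^ e` in the maximal central factor still to be processed. -/
  | centralLoop (c : ℍ[K,α,β]) (L : List ℍ[K,α,β][X]) (q : ℍ[K,α,β][X])
      (todo : List (K[X] × ℕ))
  /-- The algorithm for irreducible polynomials over `K` is being executed for `r`. -/
  | call (c : ℍ[K,α,β]) (L : List ℍ[K,α,β][X]) (q : ℍ[K,α,β][X]) (r : K[X]) (e : ℕ)
      (todo : List (K[X] × ℕ)) (s : ScalarState α β r)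
  /-- `F` holds the powers in the factorization of the norm that remain. -/
  | peel (c : ℍ[K,α,β]) (L : List ℍ[K,α,β][X]) (q : ℍ[K,α,β][X]) (F : List (K[X] × ℕ))
  | output (c : ℍ[K,α,β]) (L : List ℍ[K,α,β][X])

/-- The steps of the complete factorization algorithm. -/
inductive Step (α β : K) : State α β → State α β → Prop
  /-- Divide by the leading coefficient and initialize the list. -/
  | leadingCoeff (f : ℍ[K,α,β][X]) :
      Step α β (.start f)
        (.monic f.leadingCoeff [] (Polynomial.C (Ring.inverse f.leadingCoeff) * f))
  /-- Compute the maximal central factor `p`, the greatest common divisor of the coordinates of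
  `f`, and divide it out. -/
  | splitCentral (c : ℍ[K,α,β]) (L : List ℍ[K,α,β][X]) (f : ℍ[K,α,β][X])
      (p : K[X]) (hp : IsMonicGcd (coords f) p)
      (q : ℍ[K,α,β][X]) (hq : f = q * central α β p) :
      Step α β (.monic c L f) (.split c L q p)
  /-- Factor `p` in `K[x]`. -/
  | factorCentral (c : ℍ[K,α,β]) (L : List ℍ[K,α,β][X]) (q : ℍ[K,α,β][X]) (p : K[X])
      (todo : List (K[X] × ℕ)) (h : IsFactorization p todo) :
      Step α β (.split c L q p) (.centralLoop c L q todo)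
  /-- Start the algorithm for irreducible polynomials over `K` for the next factor `r`. -/
  | startCall (c : ℍ[K,α,β]) (L : List ℍ[K,α,β][X]) (q : ℍ[K,α,β][X]) (r : K[X]) (e : ℕ)
      (todo : List (K[X] × ℕ)) :
      Step α β (.centralLoop c L q ((r, e) :: todo)) (.call c L q r e todo .start)
  | inCall (c : ℍ[K,α,β]) (L : List ℍ[K,α,β][X]) (q : ℍ[K,α,β][X]) (r : K[X]) (e : ℕ)
      (todo : List (K[X] × ℕ)) (s t : ScalarState α β r) (h : ScalarStep α β r s t) :
      Step α β (.call c L q r e todo s) (.call c L q r e todo t)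
  /-- Append `e` copies of the output `l` to the list. -/
  | endCall (c : ℍ[K,α,β]) (L : List ℍ[K,α,β][X]) (q : ℍ[K,α,β][X]) (r : K[X]) (e : ℕ)
      (todo : List (K[X] × ℕ)) (l : List ℍ[K,α,β][X]) :
      Step α β (.call c L q r e todo (.output l))
        (.centralLoop c (L ++ (List.replicate e l).flatten) q todo)
  /-- Factor the norm of `q` in `K[x]`. -/
  | factorNorm (c : ℍ[K,α,β]) (L : List ℍ[K,α,β][X]) (q : ℍ[K,α,β][X])
      (N : K[X]) (hN : central α β N = q * conj q)
      (F : List (K[X] × ℕ)) (h : IsFactorization N F) :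
      Step α β (.centralLoop c L q []) (.peel c L q F)
  /-- While `q` is non-constant: let `g` be the last irreducible factor, `r` the greatest common
  right divisor of `q` and `g`; prepend `r` to the list, replace `q` by `q * r⁻¹`, decrement the
  exponent of `g`, and drop `g` when its exponent has become zero. -/
  | peelOff (c : ℍ[K,α,β]) (L : List ℍ[K,α,β][X]) (q : ℍ[K,α,β][X])
      (hconst : 0 < q.natDegree) (F : List (K[X] × ℕ)) (g : K[X]) (e : ℕ)
      (r : ℍ[K,α,β][X]) (hr : IsGcrd q (central α β g) r)
      (q' : ℍ[K,α,β][X]) (hq' : q = q' * r) :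
      Step α β (.peel c L q (F ++ [(g, e + 1)]))
        (.peel c (r :: L) q' (if e = 0 then F else F ++ [(g, e)]))
  /-- Once `q` is constant: output `c` and the list. -/
  | finish (c : ℍ[K,α,β]) (L : List ℍ[K,α,β][X]) (q : ℍ[K,α,β][X])
      (hconst : q.natDegree = 0) (F : List (K[X] × ℕ)) :
      Step α β (.peel c L q F) (.output c L)

/-- The state `s` can be reached when the algorithm is run on the input `f`. -/
def Reachable {α β : K} (f : ℍ[K,α,β][X]) (s : State α β) : Prop :=
  Relation.ReflTransGen (Step α β) (.start f) s

/-- `f = c * q₁ ⋯ qₙ`, where `c` is the leading coefficient of `f` and `L = [q₁, …, qₙ]` consists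
of monic irreducible quaternionic polynomials. -/
def IsCompleteFactorization {α β : K} (f : ℍ[K,α,β][X]) (c : ℍ[K,α,β])
    (L : List ℍ[K,α,β][X]) : Prop :=
  c = f.leadingCoeff ∧ (∀ q ∈ L, q.Monic ∧ Irreducible q) ∧ f = Polynomial.C c * L.prod

end Algorithms

end QuatFactor

end

/-!
The norm `f ↦ f * conj f` is multiplicative, has values in `K[x]` and doubles degrees, so a
quaternionic polynomial whose norm is irreducible over `K` is itself irreducible
(`irreducible_of_normPoly`). All factors that the algorithms produce are of this kind, with one
exception: an irreducible `p ∈ K[x]` whose root field `L` does not split the algebra. Such a `p` is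
irreducible (`irreducible_central`), because a proper factor would have norm `p` up to a constant,
and its reduction modulo `p` would be an isotropic vector of the reduced norm over `L`, which forces
splitting (`nonempty_algEquiv_matrix`).

If `L` splits the algebra and so does a quadratic subfield `S` of `L`, then `S` embeds into the
algebra (`SplitsOver.nonempty_algHom`), and the minimal polynomial over `S` of a root of `p` is
carried to a factor `f` with `p = f * conj f` (`exists_eq_mul_conj`). If there is no such subfield,
an isotropic vector modulo `p` lifts to some `f` of norm `p * q` with `deg q < deg p`. Replacing `f`
by `f * conj r / q`, where `r` is the remainder of `f` modulo `q`, gives the norm `p * q'` with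
`q' * q` the norm of `r`, whence `deg q' < deg q` (`improve_spec`).

Once the central factors have been split off, the remaining polynomial `q` is primitive. If `g` is
an irreducible factor of its norm, the greatest common right divisor of `q` and `g` has norm exactly
`g` (`IsGcrd.normPoly_eq`), so the factors of the norm can be peeled off one at a time
(`peelOff_spec`).

For the transition systems, finiteness of all runs, absence of blocked states and correctness of the
output are expressed at once by the inductive predicate `Safe`, which is established from the final
states backwards.
-/

namespace QuatFactor

/-! ### Quaternion algebras over commutative rings and fields -/

section Quaternion

variable {R : Type*} [CommRing R] {a b : R}

/-- The reduced norm of a quaternion. -/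
def qnorm (x : ℍ[R,a,b]) : R :=
  x.re ^ 2 - a * x.imI ^ 2 - b * x.imJ ^ 2 + a * b * x.imK ^ 2

theorem mul_star_eq (x : ℍ[R,a,b]) : x * star x = algebraMap R ℍ[R,a,b] (qnorm x) := by
  rw [QuaternionAlgebra.algebraMap_eq]
  ext <;> simp [qnorm] <;> ring

theorem star_mul_eq (x : ℍ[R,a,b]) : star x * x = algebraMap R ℍ[R,a,b] (qnorm x) := by
  rw [QuaternionAlgebra.algebraMap_eq]
  ext <;> simp [qnorm] <;> ring

theorem qnorm_mul (x y : ℍ[R,a,b]) : qnorm (x * y) = qnorm x * qnorm y := by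
  simp [qnorm]
  ring

@[simp] theorem qnorm_zero : qnorm (0 : ℍ[R,a,b]) = 0 := by
  simp [qnorm]

theorem star_eq_algebraMap_sub (x : ℍ[R,a,b]) :
    star x = algebraMap R ℍ[R,a,b] (2 * x.re) - x := by
  rw [QuaternionAlgebra.algebraMap_eq]
  ext <;> simp
  ring

/-- Every quaternion is a root of its reduced characteristic polynomial. -/
theorem mul_self_eq (x : ℍ[R,a,b]) :
    x * x = algebraMap R ℍ[R,a,b] (2 * x.re) * x - algebraMap R ℍ[R,a,b] (qnorm x) := by
  rw [← star_mul_eq x, star_eq_algebraMap_sub x, sub_mul]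
  abel

theorem eq_zero_of_algebraMap_mul [NoZeroDivisors R] {r : R} {x : ℍ[R,a,b]}
    (h : algebraMap R ℍ[R,a,b] r * x = 0) (hx : x ≠ 0) : r = 0 := by
  by_contra hr
  apply hx
  rw [← Algebra.smul_def] at h
  have h1 := congrArg QuaternionAlgebra.re h
  have h2 := congrArg QuaternionAlgebra.imI h
  have h3 := congrArg QuaternionAlgebra.imJ h
  have h4 := congrArg QuaternionAlgebra.imK h
  simp [hr] at h1 h2 h3 h4
  ext <;> assumption

theorem IsZeroDivisor.qnorm_eq_zero [NoZeroDivisors R] {x : ℍ[R,a,b]} (hx : IsZeroDivisor x) :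
    qnorm x = 0 := by
  obtain ⟨-, y, hy, h | h⟩ := hx
  · refine eq_zero_of_algebraMap_mul (x := y) ?_ hy
    rw [← star_mul_eq, mul_assoc, h, mul_zero]
  · refine eq_zero_of_algebraMap_mul (x := y) ?_ hy
    rw [Algebra.commutes, ← mul_star_eq, ← mul_assoc, h, zero_mul]

end Quaternion

section Division

variable {K : Type*} [Field K] {α β : K}

theorem IsDivision.noZeroDivisors (h : IsDivision ℍ[K,α,β]) : NoZeroDivisors ℍ[K,α,β] where
  eq_zero_or_eq_zero_of_mul_eq_zero {x y} hxy := by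
    by_cases hx : x = 0
    · exact Or.inl hx
    · exact Or.inr ((h.2 x hx).mul_right_eq_zero.1 hxy)

variable [NoZeroDivisors ℍ[K,α,β]]

theorem qnorm_ne_zero {x : ℍ[K,α,β]} (hx : x ≠ 0) : qnorm x ≠ 0 := by
  intro h
  have h1 := mul_star_eq x
  rw [h, map_zero] at h1
  exact (mul_ne_zero hx (star_ne_zero.2 hx)) h1

theorem isUnit_of_ne_zero {x : ℍ[K,α,β]} (hx : x ≠ 0) : IsUnit x := by
  have hu : IsUnit (algebraMap K ℍ[K,α,β] (qnorm x)) := (qnorm_ne_zero hx).isUnit.map _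
  have hc : Commute x (star x) := (mul_star_eq x).trans (star_mul_eq x).symm
  exact (hc.isUnit_mul_iff.1 (mul_star_eq x ▸ hu)).1

theorem mul_ringInverse {x : ℍ[K,α,β]} (hx : x ≠ 0) : x * Ring.inverse x = 1 :=
  Ring.mul_inverse_cancel x (isUnit_of_ne_zero hx)

theorem ringInverse_mul {x : ℍ[K,α,β]} (hx : x ≠ 0) : Ring.inverse x * x = 1 :=
  Ring.inverse_mul_cancel x (isUnit_of_ne_zero hx)

end Division

/-! ### Splitting and isotropy of the reduced norm -/

section Splitting

/-- The homomorphism into the two-by-two matrices determined by images of `i` and `j`. -/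
def matrixHom {L : Type*} [Field L] {a b : L} (I J : Matrix (Fin 2) (Fin 2) L)
    (hI : I * I = a • 1) (hJ : J * J = b • 1) (hJI : J * I = -(I * J)) :
    ℍ[L,a,b] →ₐ[L] Matrix (Fin 2) (Fin 2) L :=
  QuaternionAlgebra.Basis.liftHom
    { i := I
      j := J
      k := I * J
      i_mul_i := by simpa using hI
      j_mul_j := hJ
      i_mul_j := rfl
      j_mul_i := by simpa using hJI }

/-- A quaternion algebra with isotropic reduced norm is a matrix algebra. If `a = s ^ 2`, then `i`
acts diagonally; otherwise `b` is a norm from `L(√a)`, and the algebra acts on `L(√a)`. -/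
theorem nonempty_algEquiv_matrix {L : Type*} [Field L] [CharZero L] {a b : L} (ha : a ≠ 0)
    (hb : b ≠ 0) {x : ℍ[L,a,b]} (hx : x ≠ 0) (h : qnorm x = 0) :
    Nonempty (ℍ[L,a,b] ≃ₐ[L] Matrix (Fin 2) (Fin 2) L) := by
  suffices ∃ F : ℍ[L,a,b] →ₐ[L] Matrix (Fin 2) (Fin 2) L, Function.Injective F by
    obtain ⟨F, hF⟩ := this
    have hfin : Module.finrank L ℍ[L,a,b] = Module.finrank L (Matrix (Fin 2) (Fin 2) L) := by
      rw [QuaternionAlgebra.finrank_eq_four, Module.finrank_matrix]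
      simp
    exact ⟨AlgEquiv.ofBijective F
      ⟨hF, (LinearMap.injective_iff_surjective_of_finrank_eq_finrank
        (f := F.toLinearMap) hfin).1 hF⟩⟩
  have two : (2 : L) ≠ 0 := two_ne_zero
  by_cases hs : ∃ s, a = s * s
  · obtain ⟨s, rfl⟩ := hs
    have hs0 : s ≠ 0 := fun h0 => ha (by rw [h0, zero_mul])
    refine ⟨matrixHom !![s, 0; 0, -s] !![0, b; 1, 0] ?_ ?_ ?_, ?_⟩
    · ext i j; fin_cases i <;> fin_cases j <;> simp
    · ext i j; fin_cases i <;> fin_cases j <;> simp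
    · ext i j; fin_cases i <;> fin_cases j <;> simp [mul_comm]
    · rw [injective_iff_map_eq_zero]
      intro y hy
      have h00 := congrFun (congrFun hy 0) 0
      have h01 := congrFun (congrFun hy 0) 1
      have h10 := congrFun (congrFun hy 1) 0
      have h11 := congrFun (congrFun hy 1) 1
      simp [matrixHom, QuaternionAlgebra.Basis.liftHom, QuaternionAlgebra.Basis.lift,
        Matrix.algebraMap_eq_diagonal] at h00 h01 h10 h11
      have e01 : y.imJ + y.imK * s = 0 := by
        apply mul_left_cancel₀ hb; linear_combination h01
      have r1 : y.re = 0 := by apply mul_left_cancel₀ two; linear_combination h00 + h11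
      have r2 : y.imI = 0 := by
        apply mul_left_cancel₀ (mul_ne_zero two hs0); linear_combination h00 - h11
      have r3 : y.imJ = 0 := by apply mul_left_cancel₀ two; linear_combination e01 + h10
      have r4 : y.imK = 0 := by
        apply mul_left_cancel₀ (mul_ne_zero two hs0); linear_combination e01 - h10
      ext <;> assumption
  · have key : ∀ u v : L, u ^ 2 - a * v ^ 2 = 0 → u = 0 ∧ v = 0 := by
      intro u v huv
      by_cases hv : v = 0
      · subst hv
        exact ⟨by simpa using huv, rfl⟩
      · exfalso
        apply hs
        refine ⟨u / v, ?_⟩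
        field_simp
        linear_combination -huv
    obtain ⟨u, v, huv⟩ : ∃ u v : L, b = u ^ 2 - a * v ^ 2 := by
      set D := x.imJ ^ 2 - a * x.imK ^ 2 with hD
      have hN : x.re ^ 2 - a * x.imI ^ 2 = b * D := by
        simp only [qnorm] at h
        rw [hD]; linear_combination h
      have hD0 : D ≠ 0 := by
        intro h0
        obtain ⟨h1, h2⟩ := key _ _ (hD.symm.trans h0)
        rw [h0, mul_zero] at hN
        obtain ⟨h3, h4⟩ := key _ _ hN
        exact hx (by ext <;> assumption)
      -- the quotient of `x.re + x.imI √a` and `x.imJ + x.imK √a` has norm `b`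
      refine ⟨(x.re * x.imJ - a * x.imI * x.imK) / D, (x.imI * x.imJ - x.re * x.imK) / D, ?_⟩
      rw [div_pow, div_pow, ← mul_div_assoc, ← sub_div, eq_div_iff (pow_ne_zero 2 hD0)]
      rw [hD] at hN ⊢
      linear_combination (-(x.imJ ^ 2 - a * x.imK ^ 2)) * hN
    refine ⟨matrixHom !![0, a; 1, 0] !![u, -(a * v); v, -u] ?_ ?_ ?_, ?_⟩
    · ext i j; fin_cases i <;> fin_cases j <;> simp
    · ext i j; fin_cases i <;> fin_cases j <;> simp [huv] <;> ring
    · ext i j; fin_cases i <;> fin_cases j <;> simp [mul_comm]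
    · rw [injective_iff_map_eq_zero]
      intro y hy
      have h00 := congrFun (congrFun hy 0) 0
      have h01 := congrFun (congrFun hy 0) 1
      have h10 := congrFun (congrFun hy 1) 0
      have h11 := congrFun (congrFun hy 1) 1
      simp [matrixHom, QuaternionAlgebra.Basis.liftHom, QuaternionAlgebra.Basis.lift,
        Matrix.algebraMap_eq_diagonal] at h00 h01 h10 h11
      have e01 : y.imI - y.imJ * v - y.imK * u = 0 := by
        apply mul_left_cancel₀ ha; linear_combination h01
      have r1 : y.re = 0 := by apply mul_left_cancel₀ two; linear_combination h00 + h11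
      have r2 : y.imI = 0 := by apply mul_left_cancel₀ two; linear_combination e01 + h10
      have e1 : y.imJ * u + y.imK * (a * v) = 0 := by
        apply mul_left_cancel₀ two; linear_combination h00 - h11
      have e2 : y.imJ * v + y.imK * u = 0 := by
        apply mul_left_cancel₀ two; linear_combination h10 - e01
      have r3 : y.imJ = 0 := by
        apply mul_left_cancel₀ hb; linear_combination u * e1 - a * v * e2 + y.imJ * huv
      have r4 : y.imK = 0 := by
        apply mul_left_cancel₀ hb; linear_combination u * e2 - v * e1 + y.imK * huv
      ext <;> assumption

variable {K : Type*} [Field K] {α β : K}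

/-- Over a splitting ring there is a nonzero quaternion of square zero. -/
theorem SplitsOver.exists_mul_self_eq_zero {L : Type*} [CommRing L] [Nontrivial L] [Algebra K L]
    (h : SplitsOver α β L) : ∃ x : BaseChange α β L, x ≠ 0 ∧ x * x = 0 := by
  obtain ⟨e⟩ := h
  refine ⟨e.symm !![0, 1; 0, 0], ?_, ?_⟩
  · intro h0
    have h1 : (!![0, 1; 0, 0] : Matrix (Fin 2) (Fin 2) L) = 0 := by
      simpa using h0
    simpa using congrFun (congrFun h1 0) 1
  · rw [← map_mul]
    have h1 : (!![0, 1; 0, 0] : Matrix (Fin 2) (Fin 2) L) * !![0, 1; 0, 0] = 0 := by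
      ext i j; fin_cases i <;> fin_cases j <;> simp
    rw [h1, map_zero]

theorem SplitsOver.exists_qnorm_eq_zero {L : Type*} [CommRing L] [IsDomain L] [Algebra K L]
    (h : SplitsOver α β L) : ∃ x : BaseChange α β L, x ≠ 0 ∧ qnorm x = 0 := by
  obtain ⟨x, hx, hxx⟩ := h.exists_mul_self_eq_zero
  exact ⟨x, hx, IsZeroDivisor.qnorm_eq_zero ⟨hx, x, hx, Or.inl hxx⟩⟩

theorem splitsOver_of_qnorm_eq_zero [CharZero K] {L : Type*} [Field L] [Algebra K L]
    (hα : α ≠ 0) (hβ : β ≠ 0) {x : BaseChange α β L} (hx : x ≠ 0) (h : qnorm x = 0) :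
    SplitsOver α β L :=
  have : CharZero L := charZero_of_injective_algebraMap (algebraMap K L).injective
  nonempty_algEquiv_matrix (by simpa using hα) (by simpa using hβ) hx h

/-- A quadratic extension that splits a quaternion division algebra embeds into it. If
`x = x₀ + g x₁` is an isotropic vector of the reduced norm over `S = K(g)`, with `x₀` and `x₁` in
the algebra, then `-x₀ x₁⁻¹` is a root of the minimal polynomial of `g`. -/
theorem SplitsOver.nonempty_algHom [CharZero K] [NoZeroDivisors ℍ[K,α,β]]
    {S : Type*} [Field S] [Algebra K S] (hS : Module.finrank K S = 2) (h : SplitsOver α β S) :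
    Nonempty (S →ₐ[K] ℍ[K,α,β]) := by
  have : FiniteDimensional K S := Module.finite_of_finrank_pos (by omega)
  let pb := Field.powerBasisOfFiniteOfSeparable K S
  have hdim : pb.dim = 2 := by rw [← pb.finrank, hS]
  set g := pb.gen with hg
  have hspan : ∀ y : S, ∃ u v : K, y = algebraMap K S u + g * algebraMap K S v := by
    intro y
    obtain ⟨f, hdeg, rfl⟩ := pb.exists_eq_aeval y
    refine ⟨f.coeff 0, f.coeff 1, ?_⟩
    conv_lhs => rw [Polynomial.eq_X_add_C_of_natDegree_le_one (p := f) (by omega)]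
    simp [hg]
    ring
  obtain ⟨x, hx, hN⟩ := h.exists_qnorm_eq_zero
  obtain ⟨u₀, v₀, h₀⟩ := hspan x.re
  obtain ⟨u₁, v₁, h₁⟩ := hspan x.imI
  obtain ⟨u₂, v₂, h₂⟩ := hspan x.imJ
  obtain ⟨u₃, v₃, h₃⟩ := hspan x.imK
  -- `x = x₀ + g x₁` with `x₀` and `x₁` in the algebra over `K`
  let x₀ : ℍ[K,α,β] := ⟨u₀, u₁, u₂, u₃⟩
  let x₁ : ℍ[K,α,β] := ⟨v₀, v₁, v₂, v₃⟩
  have hexp : algebraMap K S (qnorm x₀) + algebraMap K S (2 * (x₀ * star x₁).re) * g +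
      algebraMap K S (qnorm x₁) * g ^ 2 = 0 := by
    rw [← hN]
    simp only [qnorm, h₀, h₁, h₂, h₃]
    have h2 : algebraMap K S 2 = 2 := map_ofNat _ 2
    simp [x₀, x₁, h2]
    ring
  have hx₁ : x₁ ≠ 0 := by
    intro h0
    rw [h0, star_zero, mul_zero] at hexp
    have hx₀ : x₀ = 0 := by
      by_contra hx₀
      exact qnorm_ne_zero hx₀ (by simpa using hexp)
    have e0 : u₀ = 0 ∧ u₁ = 0 ∧ u₂ = 0 ∧ u₃ = 0 := by
      simpa [x₀, QuaternionAlgebra.ext_iff] using hx₀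
    have e1 : v₀ = 0 ∧ v₁ = 0 ∧ v₂ = 0 ∧ v₃ = 0 := by
      simpa [x₁, QuaternionAlgebra.ext_iff] using h0
    obtain ⟨rfl, rfl, rfl, rfl⟩ := e0
    obtain ⟨rfl, rfl, rfl, rfl⟩ := e1
    apply hx
    ext <;> simp [h₀, h₁, h₂, h₃]
  have hn := qnorm_ne_zero hx₁
  set n := qnorm x₁ with hn_def
  -- `t = -x₀ x₁⁻¹`
  let t : ℍ[K,α,β] := -n⁻¹ • (x₀ * star x₁)
  have htr : 2 * t.re = -(n⁻¹ * (2 * (x₀ * star x₁).re)) := by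
    simp only [t, QuaternionAlgebra.re_smul, smul_eq_mul]
    ring
  have htn : qnorm t = n⁻¹ * qnorm x₀ := by
    have h1 : qnorm (star x₁) = n := by simp [hn_def, qnorm]
    have h2 : qnorm t = n⁻¹ ^ 2 * qnorm (x₀ * star x₁) := by
      simp only [t, qnorm, QuaternionAlgebra.re_smul, QuaternionAlgebra.imI_smul,
        QuaternionAlgebra.imJ_smul, QuaternionAlgebra.imK_smul, smul_eq_mul]
      ring
    rw [h2, qnorm_mul, h1]
    field_simp
  have hmin : minpoly K g =
      Polynomial.X ^ 2 + (Polynomial.C (-(2 * t.re)) * Polynomial.X + Polynomial.C (qnorm t)) := by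
    have hlt : (Polynomial.C (-(2 * t.re)) * Polynomial.X + Polynomial.C (qnorm t)).degree
        < ((2 : ℕ) : WithBot ℕ) := Polynomial.degree_linear_lt
    refine (Polynomial.eq_of_monic_of_dvd_of_natDegree_le (minpoly.monic pb.isIntegral_gen)
      (Polynomial.monic_X_pow_add hlt) (minpoly.dvd K g ?_) ?_).symm
    · have hS0 : algebraMap K S n ≠ 0 := by simpa using hn
      rw [htr, htn]
      simp only [map_add, map_pow, map_mul, Polynomial.aeval_X, Polynomial.aeval_C,
        neg_neg, map_inv₀]
      simp only [map_mul] at hexp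
      apply mul_left_cancel₀ hS0
      field_simp
      linear_combination hexp
    · rw [pb.natDegree_minpoly, hdim, Polynomial.natDegree_eq_of_degree_eq_some
        (Polynomial.degree_add_eq_left_of_degree_lt (by simpa using hlt) |>.trans
          (Polynomial.degree_X_pow 2))]
  refine ⟨pb.lift t ?_⟩
  rw [← hg, hmin]
  simp only [map_add, map_pow, map_mul, map_neg, Polynomial.aeval_X, Polynomial.aeval_C]
  rw [pow_two, mul_self_eq t, map_mul]
  noncomm_ring

end Splitting

/-! ### Conjugation and coordinates of quaternionic polynomials -/

section Arithmetic

variable {K : Type*} [Field K] {α β : K}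

@[simp] theorem coeff_conj (f : ℍ[K,α,β][X]) (n : ℕ) : (conj f).coeff n = star (f.coeff n) := by
  rw [conj, Polynomial.sum_def, Polynomial.finsetSum_coeff]
  simp only [Polynomial.coeff_monomial, Finset.sum_ite_eq', Polynomial.mem_support_iff]
  split_ifs with h
  · rfl
  · rw [Polynomial.notMem_support_iff.1 h, star_zero]

@[simp] theorem coeff_coord (φ : ℍ[K,α,β] →ₗ[K] K) (f : ℍ[K,α,β][X]) (n : ℕ) :
    (coord φ f).coeff n = φ (f.coeff n) := by
  rw [coord, Polynomial.sum_def, Polynomial.finsetSum_coeff]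
  simp only [Polynomial.coeff_monomial, Finset.sum_ite_eq', Polynomial.mem_support_iff]
  split_ifs with h
  · rfl
  · rw [Polynomial.notMem_support_iff.1 h, map_zero]

@[simp] theorem coord_zero (φ : ℍ[K,α,β] →ₗ[K] K) : coord φ 0 = 0 := by
  ext
  simp

@[simp] theorem coeff_central (p : K[X]) (n : ℕ) :
    (central α β p).coeff n = algebraMap K _ (p.coeff n) := by
  simp [central]

theorem central_mul (p q : K[X]) : central α β (p * q) = central α β p * central α β q := by
  simp [central]

@[simp] theorem central_one : central α β (1 : K[X]) = 1 := by
  simp [central]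

theorem central_pow (p : K[X]) (n : ℕ) : central α β (p ^ n) = central α β p ^ n := by
  simp [central]

theorem central_injective : Function.Injective (central α β) :=
  Polynomial.map_injective _ (algebraMap K ℍ[K,α,β]).injective

theorem central_ne_zero {p : K[X]} (hp : p ≠ 0) : central α β p ≠ 0 := by
  intro h
  exact hp (central_injective (α := α) (β := β) (by simpa [central] using h))

@[simp] theorem degree_central (p : K[X]) : (central α β p).degree = p.degree :=
  Polynomial.degree_map _ _

@[simp] theorem natDegree_central (p : K[X]) : (central α β p).natDegree = p.natDegree :=
  Polynomial.natDegree_map _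

theorem monic_central {p : K[X]} : (central α β p).Monic ↔ p.Monic :=
  Polynomial.monic_map_iff

theorem central_mul_comm (p : K[X]) (f : ℍ[K,α,β][X]) :
    central α β p * f = f * central α β p := by
  ext1 n
  rw [Polynomial.coeff_mul, Polynomial.coeff_mul, ← Finset.Nat.sum_antidiagonal_swap]
  exact Finset.sum_congr rfl fun x _ => by
    simpa using Algebra.commutes (p.coeff x.2) (f.coeff x.1)

@[simp] theorem conj_conj (f : ℍ[K,α,β][X]) : conj (conj f) = f := by
  ext1 n
  simp

theorem conj_add (f g : ℍ[K,α,β][X]) : conj (f + g) = conj f + conj g := by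
  ext1 n
  simp

theorem conj_mul (f g : ℍ[K,α,β][X]) : conj (f * g) = conj g * conj f := by
  ext1 n
  rw [coeff_conj, Polynomial.coeff_mul, Polynomial.coeff_mul, ← Finset.Nat.sum_antidiagonal_swap,
    star_sum]
  exact Finset.sum_congr rfl fun x _ => by simp

@[simp] theorem conj_zero : conj (0 : ℍ[K,α,β][X]) = 0 := by
  ext1 n
  simp

@[simp] theorem conj_C (a : ℍ[K,α,β]) : conj (Polynomial.C a) = Polynomial.C (star a) := by
  ext1 n
  rw [coeff_conj, Polynomial.coeff_C, Polynomial.coeff_C]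
  split_ifs <;> simp

@[simp] theorem conj_central (p : K[X]) : conj (central α β p) = central α β p := by
  ext1 n
  rw [coeff_conj, coeff_central]
  exact QuaternionAlgebra.star_coe _

@[simp] theorem conj_eq_zero {f : ℍ[K,α,β][X]} : conj f = 0 ↔ f = 0 :=
  ⟨fun h => by rw [← conj_conj f, h, conj_zero], fun h => by rw [h, conj_zero]⟩

@[simp] theorem degree_conj (f : ℍ[K,α,β][X]) : (conj f).degree = f.degree := by
  have h : (conj f).support = f.support := by
    ext n
    simp
  rw [Polynomial.degree, Polynomial.degree, h]

@[simp] theorem natDegree_conj (f : ℍ[K,α,β][X]) : (conj f).natDegree = f.natDegree :=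
  Polynomial.natDegree_eq_of_degree_eq (degree_conj f)

@[simp] theorem leadingCoeff_conj (f : ℍ[K,α,β][X]) :
    (conj f).leadingCoeff = star f.leadingCoeff := by
  rw [Polynomial.leadingCoeff, natDegree_conj, coeff_conj]
  rfl

theorem monic_conj {f : ℍ[K,α,β][X]} (hf : f.Monic) : (conj f).Monic := by
  rw [Polynomial.Monic, leadingCoeff_conj, hf.leadingCoeff, star_one]

/-- A polynomial is determined by its coordinates. -/
theorem ext_coord {f g : ℍ[K,α,β][X]}
    (h₀ : coord (QuaternionAlgebra.reₗ α 0 β) f = coord (QuaternionAlgebra.reₗ α 0 β) g)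
    (h₁ : coord (QuaternionAlgebra.imIₗ α 0 β) f = coord (QuaternionAlgebra.imIₗ α 0 β) g)
    (h₂ : coord (QuaternionAlgebra.imJₗ α 0 β) f = coord (QuaternionAlgebra.imJₗ α 0 β) g)
    (h₃ : coord (QuaternionAlgebra.imKₗ α 0 β) f = coord (QuaternionAlgebra.imKₗ α 0 β) g) :
    f = g := by
  ext1 n
  have e₀ := congrArg (Polynomial.coeff · n) h₀
  have e₁ := congrArg (Polynomial.coeff · n) h₁
  have e₂ := congrArg (Polynomial.coeff · n) h₂
  have e₃ := congrArg (Polynomial.coeff · n) h₃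
  simp only [coeff_coord] at e₀ e₁ e₂ e₃
  exact QuaternionAlgebra.ext e₀ e₁ e₂ e₃

theorem exists_coords_eq (a b c d : K[X]) : ∃ f : ℍ[K,α,β][X],
    coord (QuaternionAlgebra.reₗ α 0 β) f = a ∧ coord (QuaternionAlgebra.imIₗ α 0 β) f = b ∧
    coord (QuaternionAlgebra.imJₗ α 0 β) f = c ∧ coord (QuaternionAlgebra.imKₗ α 0 β) f = d := by
  refine ⟨central α β a + central α β b * Polynomial.C ⟨0, 1, 0, 0⟩ +
    central α β c * Polynomial.C ⟨0, 0, 1, 0⟩ + central α β d * Polynomial.C ⟨0, 0, 0, 1⟩,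
    ?_, ?_, ?_, ?_⟩ <;>
  · ext n
    simp [QuaternionAlgebra.algebraMap_eq]

theorem coord_mul_central (φ : ℍ[K,α,β] →ₗ[K] K) (f : ℍ[K,α,β][X]) (p : K[X]) :
    coord φ (f * central α β p) = coord φ f * p := by
  ext n
  rw [coeff_coord, Polynomial.coeff_mul, Polynomial.coeff_mul, map_sum]
  refine Finset.sum_congr rfl fun x _ => ?_
  rw [coeff_central, coeff_coord, ← Algebra.commutes, ← Algebra.smul_def, map_smul, smul_eq_mul,
    mul_comm]

theorem forall_coords_dvd_iff {f : ℍ[K,α,β][X]} {e : K[X]} :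
    (∀ h ∈ coords f, e ∣ h) ↔ ∃ g, f = g * central α β e := by
  constructor
  · intro h
    simp only [coords, List.mem_cons, List.not_mem_nil, or_false, forall_eq_or_imp,
      forall_eq] at h
    obtain ⟨⟨a, ha⟩, ⟨b, hb⟩, ⟨c, hc⟩, ⟨d, hd⟩⟩ := h
    obtain ⟨g, ga, gb, gc, gd⟩ := exists_coords_eq (α := α) (β := β) a b c d
    refine ⟨g, ext_coord ?_ ?_ ?_ ?_⟩
    · rw [ha, coord_mul_central, ga, mul_comm]
    · rw [hb, coord_mul_central, gb, mul_comm]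
    · rw [hc, coord_mul_central, gc, mul_comm]
    · rw [hd, coord_mul_central, gd, mul_comm]
  · rintro ⟨g, rfl⟩
    simp [coords, coord_mul_central]

theorem degree_coord_le (φ : ℍ[K,α,β] →ₗ[K] K) (f : ℍ[K,α,β][X]) :
    (coord φ f).degree ≤ f.degree := by
  rw [Polynomial.degree_le_iff_coeff_zero]
  intro n hn
  rw [coeff_coord, Polynomial.coeff_eq_zero_of_degree_lt hn, map_zero]

/-! ### Division and greatest common right divisors -/

section RightDivision

variable [NoZeroDivisors ℍ[K,α,β]]

theorem exists_right_division (f : ℍ[K,α,β][X]) {d : ℍ[K,α,β][X]} (hd : d ≠ 0) :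
    ∃ h r, f = h * d + r ∧ r.degree < d.degree := by
  have hlc : (conj d).leadingCoeff ≠ 0 := by simpa using hd
  set u := Ring.inverse (conj d).leadingCoeff with hu
  have hu0 : u ≠ 0 := by
    intro h0
    have := mul_ringInverse hlc
    rw [← hu, h0, mul_zero] at this
    exact zero_ne_one this
  -- conjugation turns division by a monic divisor on the left into division on the right
  set m := conj d * Polynomial.C u with hm
  have hmon : m.Monic := by
    rw [Polynomial.Monic, hm, Polynomial.leadingCoeff_mul, Polynomial.leadingCoeff_C,
      mul_ringInverse hlc]
  have hdeg : m.degree = d.degree := by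
    rw [hm, Polynomial.degree_mul, Polynomial.degree_C hu0, add_zero, degree_conj]
  have hdiv := Polynomial.modByMonic_add_div (conj f) m
  refine ⟨conj (conj f /ₘ m) * Polynomial.C (star u), conj (conj f %ₘ m), ?_, ?_⟩
  · have h1 := congrArg conj hdiv
    rw [conj_add, conj_conj, conj_mul, hm, conj_mul, conj_conj, conj_C] at h1
    rw [mul_assoc, add_comm]
    exact h1.symm
  · rw [degree_conj, ← hdeg]
    exact Polynomial.degree_modByMonic_lt _ hmon

/-- Greatest common right divisors exist, because left ideals are principal. -/
theorem exists_isGcrd {f g : ℍ[K,α,β][X]} (hf : f ≠ 0) :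
    ∃ d, IsGcrd f g d ∧ ∃ a b, d = a * f + b * g := by
  classical
  have hex : ∃ n, ∃ d a b : ℍ[K,α,β][X], d = a * f + b * g ∧ d ≠ 0 ∧ d.natDegree = n :=
    ⟨_, f, 1, 0, by simp, hf, rfl⟩
  obtain ⟨d, a, b, hd, hd0, hdn⟩ := Nat.find_spec hex
  have hmin : ∀ a' b' : ℍ[K,α,β][X], RightDvd d (a' * f + b' * g) := by
    intro a' b'
    obtain ⟨h, r, hr, hlt⟩ := exists_right_division (a' * f + b' * g) hd0
    refine ⟨h, ?_⟩
    by_cases hr0 : r = 0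
    · rw [hr, hr0, add_zero]
    · exfalso
      refine Nat.find_min hex (m := r.natDegree) ?_
        ⟨r, a' - h * a, b' - h * b, ?_, hr0, rfl⟩
      · rw [← hdn]
        exact Polynomial.natDegree_lt_natDegree hr0 hlt
      · rw [eq_sub_of_add_eq' hr.symm, hd]
        noncomm_ring
  have hlc : d.leadingCoeff ≠ 0 := by simpa using hd0
  have hback : d =
      Polynomial.C d.leadingCoeff * (Polynomial.C (Ring.inverse d.leadingCoeff) * d) := by
    rw [← mul_assoc, ← Polynomial.C_mul, mul_ringInverse hlc, Polynomial.C_1, one_mul]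
  have hdvd : ∀ e, RightDvd d e →
      RightDvd (Polynomial.C (Ring.inverse d.leadingCoeff) * d) e := by
    rintro e ⟨h, rfl⟩
    refine ⟨h * Polynomial.C d.leadingCoeff, ?_⟩
    rw [mul_assoc, ← hback]
  refine ⟨Polynomial.C (Ring.inverse d.leadingCoeff) * d, ⟨?_, ?_, ?_, ?_⟩,
    Polynomial.C (Ring.inverse d.leadingCoeff) * a, Polynomial.C (Ring.inverse d.leadingCoeff) * b,
    ?_⟩
  · rw [Polynomial.Monic, Polynomial.leadingCoeff_mul, Polynomial.leadingCoeff_C,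
      ringInverse_mul hlc]
  · exact hdvd _ (by simpa using hmin 1 0)
  · exact hdvd _ (by simpa using hmin 0 1)
  · rintro e ⟨x, rfl⟩ ⟨y, rfl⟩
    refine ⟨Polynomial.C (Ring.inverse d.leadingCoeff) * (a * x + b * y), ?_⟩
    rw [mul_assoc, add_mul, mul_assoc, mul_assoc, ← hd]
  · rw [mul_assoc, mul_assoc, ← mul_add, ← hd]

/-- Every greatest common right divisor satisfies a Bézout identity. -/
theorem IsGcrd.exists_bezout {f g r : ℍ[K,α,β][X]} (h : IsGcrd f g r) (hf : f ≠ 0) :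
    ∃ a b, r = a * f + b * g := by
  obtain ⟨d, hd, a, b, hab⟩ := exists_isGcrd (g := g) hf
  obtain ⟨x, hx⟩ := h.2.2.2 d hd.2.1 hd.2.2.1
  exact ⟨x * a, x * b, by rw [hx, hab]; noncomm_ring⟩

end RightDivision

/-! ### The norm -/

/-- The norm of a quaternionic polynomial, as a polynomial over the base field. -/
noncomputable def normPoly (f : ℍ[K,α,β][X]) : K[X] :=
  coord (QuaternionAlgebra.reₗ α 0 β) (f * conj f)

theorem normPoly_eq (f : ℍ[K,α,β][X]) : normPoly f =
    coord (QuaternionAlgebra.reₗ α 0 β) f ^ 2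
      - Polynomial.C α * coord (QuaternionAlgebra.imIₗ α 0 β) f ^ 2
      - Polynomial.C β * coord (QuaternionAlgebra.imJₗ α 0 β) f ^ 2
      + Polynomial.C (α * β) * coord (QuaternionAlgebra.imKₗ α 0 β) f ^ 2 := by
  ext n
  simp only [normPoly, coeff_coord, pow_two, Polynomial.coeff_add, Polynomial.coeff_sub,
    Polynomial.coeff_C_mul]
  simp only [Polynomial.coeff_mul, coeff_coord, map_sum, Finset.mul_sum,
    ← Finset.sum_add_distrib, ← Finset.sum_sub_distrib]
  refine Finset.sum_congr rfl fun x _ => ?_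
  simp
  ring

@[simp] theorem normPoly_zero : normPoly (0 : ℍ[K,α,β][X]) = 0 := by
  ext n
  simp [normPoly]

variable [CharZero K]

theorem central_normPoly (f : ℍ[K,α,β][X]) : central α β (normPoly f) = f * conj f := by
  ext1 n
  have h : conj (f * conj f) = f * conj f := by rw [conj_mul, conj_conj]
  have h1 := congrArg (Polynomial.coeff · n) h
  simp only [coeff_conj] at h1
  rw [coeff_central, normPoly, coeff_coord]
  exact (QuaternionAlgebra.star_eq_self.1 h1).symm

theorem normPoly_eq_of_central_eq {f : ℍ[K,α,β][X]} {p : K[X]}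
    (h : central α β p = f * conj f) : normPoly f = p :=
  central_injective ((central_normPoly f).trans h.symm)

theorem normPoly_mul (f g : ℍ[K,α,β][X]) : normPoly (f * g) = normPoly f * normPoly g := by
  apply normPoly_eq_of_central_eq
  rw [conj_mul, central_mul, mul_assoc f g, ← mul_assoc g, ← central_normPoly g, central_mul_comm,
    ← mul_assoc, central_normPoly f, ← mul_assoc, central_mul_comm]

@[simp] theorem normPoly_central (p : K[X]) : normPoly (central α β p) = p ^ 2 :=
  normPoly_eq_of_central_eq (by rw [conj_central, pow_two, central_mul])

@[simp] theorem normPoly_one : normPoly (1 : ℍ[K,α,β][X]) = 1 := by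
  simpa using normPoly_central (α := α) (β := β) 1

theorem monic_normPoly {f : ℍ[K,α,β][X]} (hf : f.Monic) : (normPoly f).Monic := by
  rw [← monic_central (α := α) (β := β), central_normPoly]
  exact Polynomial.Monic.mul hf (monic_conj hf)

variable [NoZeroDivisors ℍ[K,α,β]]

theorem conj_mul_self (f : ℍ[K,α,β][X]) : conj f * f = central α β (normPoly f) := by
  by_cases hf : f = 0
  · simp [hf, central]
  · apply mul_left_cancel₀ hf
    rw [← mul_assoc, ← central_normPoly, central_mul_comm]

@[simp] theorem normPoly_conj (f : ℍ[K,α,β][X]) : normPoly (conj f) = normPoly f :=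
  normPoly_eq_of_central_eq (by rw [conj_conj, conj_mul_self])

@[simp] theorem normPoly_eq_zero {f : ℍ[K,α,β][X]} : normPoly f = 0 ↔ f = 0 := by
  refine ⟨fun h => ?_, fun h => by rw [h, normPoly_zero]⟩
  have h1 := central_normPoly f
  rw [h] at h1
  rcases mul_eq_zero.1 (h1.symm.trans (by simp [central])) with h2 | h2
  · exact h2
  · exact conj_eq_zero.1 h2

theorem natDegree_normPoly (f : ℍ[K,α,β][X]) : (normPoly f).natDegree = 2 * f.natDegree := by
  by_cases hf : f = 0
  · simp [hf]
  · rw [← natDegree_central (α := α) (β := β), central_normPoly,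
      Polynomial.natDegree_mul hf (by simpa using hf), natDegree_conj, two_mul]

theorem isUnit_normPoly_iff {f : ℍ[K,α,β][X]} : IsUnit (normPoly f) ↔ IsUnit f := by
  constructor
  · intro h
    have hu : IsUnit (central α β (normPoly f)) := h.map (Polynomial.mapRingHom _)
    have hc : Commute f (conj f) := (central_normPoly f).symm.trans (conj_mul_self f).symm
    exact (hc.isUnit_mul_iff.1 (central_normPoly f ▸ hu)).1
  · rintro ⟨u, rfl⟩
    refine IsUnit.of_mul_eq_one (normPoly (↑u⁻¹ : ℍ[K,α,β][X])) ?_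
    rw [← normPoly_mul, Units.mul_inv, normPoly_one]

theorem irreducible_of_normPoly {f : ℍ[K,α,β][X]} (h : Irreducible (normPoly f)) :
    Irreducible f where
  not_isUnit hf := h.not_isUnit (isUnit_normPoly_iff.2 hf)
  isUnit_or_isUnit a b hab := by
    rw [← isUnit_normPoly_iff, ← isUnit_normPoly_iff (f := b)]
    exact h.isUnit_or_isUnit (by rw [hab, normPoly_mul])

/-! ### Right factors of primitive polynomials -/

/-- A quaternionic polynomial without non-trivial central factors. -/
def IsPrimitive (q : ℍ[K,α,β][X]) : Prop :=
  ∀ e : K[X], (∃ h, q = h * central α β e) → IsUnit e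

/-- A primitive polynomial whose norm is divisible by the irreducible `g` has a right factor of
norm `g`. Norm `1` is impossible: multiplying a Bézout identity `1 = a q + b g` by the conjugate
of `q` exhibits `g` as a factor of that conjugate. Norm `g ^ 2` would make `g` a factor of `q`. -/
theorem IsGcrd.normPoly_eq {q r : ℍ[K,α,β][X]} {g : K[X]} (hq : q ≠ 0) (hprim : IsPrimitive q)
    (hg : g.Monic) (hirr : Irreducible g) (hdvd : g ∣ normPoly q)
    (hr : IsGcrd q (central α β g) r) : normPoly r = g := by
  obtain ⟨h, hh⟩ := hr.2.2.1
  obtain ⟨q', hq'⟩ := hr.2.1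
  have hN : g ^ 2 = normPoly h * normPoly r := by
    rw [← normPoly_mul, ← hh, normPoly_central]
  obtain ⟨i, hi, hass⟩ := (dvd_prime_pow hirr.prime 2).1 (Dvd.intro_left _ hN.symm)
  have hri : normPoly r = g ^ i :=
    Polynomial.eq_of_monic_of_associated (monic_normPoly hr.1) (hg.pow i) hass
  interval_cases i
  · exfalso
    rw [pow_zero] at hri
    have hru : IsUnit r := isUnit_normPoly_iff.1 (by rw [hri]; exact isUnit_one)
    have hr1 : r = 1 := by
      apply hr.1.natDegree_eq_zero.1
      have := natDegree_normPoly r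
      rw [hri, Polynomial.natDegree_one] at this
      omega
    obtain ⟨a, b, hab⟩ := hr.exists_bezout hq
    obtain ⟨s, hs⟩ := hdvd
    have hc : conj q = (a * central α β s + b * conj q) * central α β g := by
      calc conj q = r * conj q := by rw [hr1, one_mul]
        _ = a * (q * conj q) + b * (central α β g * conj q) := by rw [hab]; noncomm_ring
        _ = _ := by
          rw [← central_normPoly, hs, central_mul, central_mul_comm g, central_mul_comm g]
          noncomm_ring
    apply hirr.not_isUnit (hprim g ⟨conj (a * central α β s + b * conj q), ?_⟩)
    have hc' := congrArg conj hc
    rw [conj_conj, conj_mul, conj_central, central_mul_comm] at hc'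
    exact hc'
  · rw [hri, pow_one]
  · exfalso
    have hh1 : normPoly h = 1 := by
      apply mul_right_cancel₀ (pow_ne_zero 2 hirr.ne_zero)
      rw [one_mul, ← hri, ← hN, hri]
    refine hirr.not_isUnit (hprim g ⟨q' * conj h, ?_⟩)
    rw [hh, ← mul_assoc, mul_assoc q', conj_mul_self, hh1, central_one, mul_one, ← hq']

end Arithmetic

/-! ### Greatest common divisors and factorization over the base field -/

section BaseField

variable {K : Type*} [Field K]

theorem exists_isMonicGcd {l : List K[X]} (hl : ∃ f ∈ l, f ≠ 0) : ∃ d, IsMonicGcd l d := by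
  classical
  have hex : ∀ l : List K[X], ∃ d, (∀ f ∈ l, d ∣ f) ∧ ∀ e, (∀ f ∈ l, e ∣ f) → e ∣ d := by
    intro l
    induction l with
    | nil => exact ⟨0, by simp⟩
    | cons a l ih =>
      obtain ⟨d, h1, h2⟩ := ih
      refine ⟨EuclideanDomain.gcd a d, ?_, fun e he => EuclideanDomain.dvd_gcd (he a (by simp))
        (h2 e fun f hf => he f (by simp [hf]))⟩
      intro f hf
      rcases List.mem_cons.1 hf with rfl | hf
      · exact EuclideanDomain.gcd_dvd_left _ _
      · exact (EuclideanDomain.gcd_dvd_right _ _).trans (h1 f hf)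
  obtain ⟨d, h1, h2⟩ := hex l
  have hd : d ≠ 0 := by
    rintro rfl
    obtain ⟨f, hf, hf0⟩ := hl
    exact hf0 (zero_dvd_iff.1 (h1 f hf))
  refine ⟨normalize d, Polynomial.monic_normalize hd, fun f hf => normalize_dvd_iff.2 (h1 f hf),
    fun e he => dvd_normalize_iff.2 (h2 e he)⟩

open UniqueFactorizationMonoid in
theorem exists_isFactorization {f : K[X]} (hf : f.Monic) : ∃ l, IsFactorization f l := by
  classical
  refine ⟨(normalizedFactors f).toFinset.toList.map
    fun t => (t, (normalizedFactors f).count t), ?_, ?_, ?_⟩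
  · rw [List.map_map]
    exact (List.map_id _).symm ▸ Finset.nodup_toList _
  · intro t ht
    obtain ⟨r, hr, rfl⟩ := List.mem_map.1 ht
    rw [Finset.mem_toList, Multiset.mem_toFinset] at hr
    refine ⟨?_, irreducible_of_normalized_factor r hr, Multiset.count_pos.2 hr⟩
    rw [← normalize_normalized_factor r hr]
    exact Polynomial.monic_normalize (irreducible_of_normalized_factor r hr).ne_zero
  · rw [List.map_map]
    have h := Finset.prod_multiset_count (normalizedFactors f)
    rw [← Finset.prod_map_toList] at h
    refine h.symm.trans (Polynomial.eq_of_monic_of_associated ?_ hf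
      (prod_normalizedFactors hf.ne_zero))
    rw [prod_normalizedFactors_eq hf.ne_zero]
    exact Polynomial.monic_normalize hf.ne_zero

end BaseField

/-! ### Reduction modulo a polynomial over the base field -/

section Reduction

variable {K : Type*} [Field K] {α β : K}

theorem qnorm_reduce (p : K[X]) (f : ℍ[K,α,β][X]) :
    qnorm (reduce p f) = AdjoinRoot.mk p (normPoly f) := by
  rw [normPoly_eq]
  simp [qnorm, reduce, AdjoinRoot.algebraMap_eq]

theorem reduce_ne_zero {p : K[X]} {f : ℍ[K,α,β][X]} (hdeg : f.degree < p.degree) (hf : f ≠ 0) :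
    reduce p f ≠ 0 := by
  intro h
  apply hf
  have key : ∀ φ : ℍ[K,α,β] →ₗ[K] K, AdjoinRoot.mk p (coord φ f) = 0 → coord φ f = 0 := by
    intro φ hφ
    exact Polynomial.eq_zero_of_dvd_of_degree_lt (AdjoinRoot.mk_eq_zero.1 hφ)
      ((degree_coord_le φ f).trans_lt hdeg)
  apply ext_coord
  · rw [coord_zero]; exact key _ (congrArg QuaternionAlgebra.re h)
  · rw [coord_zero]; exact key _ (congrArg QuaternionAlgebra.imI h)
  · rw [coord_zero]; exact key _ (congrArg QuaternionAlgebra.imJ h)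
  · rw [coord_zero]; exact key _ (congrArg QuaternionAlgebra.imK h)

theorem exists_reduce_eq {p : K[X]} (hp : p.Monic) (x : BaseChange α β (AdjoinRoot p)) :
    ∃ f : ℍ[K,α,β][X], reduce p f = x ∧ f.degree < p.degree := by
  have key : ∀ y : AdjoinRoot p, ∃ c : K[X], AdjoinRoot.mk p c = y ∧ c.degree < p.degree := by
    intro y
    obtain ⟨c, rfl⟩ := AdjoinRoot.mk_surjective y
    refine ⟨c %ₘ p, ?_, Polynomial.degree_modByMonic_lt _ hp⟩
    conv_rhs => rw [← Polynomial.modByMonic_add_div c p]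
    simp
  obtain ⟨a, ha, da⟩ := key x.re
  obtain ⟨b, hb, db⟩ := key x.imI
  obtain ⟨c, hc, dc⟩ := key x.imJ
  obtain ⟨d, hd, dd⟩ := key x.imK
  obtain ⟨f, fa, fb, fc, fd⟩ := exists_coords_eq (α := α) (β := β) a b c d
  refine ⟨f, QuaternionAlgebra.ext ?_ ?_ ?_ ?_, ?_⟩
  · simp [reduce, fa, ha]
  · simp [reduce, fb, hb]
  · simp [reduce, fc, hc]
  · simp [reduce, fd, hd]
  · rw [Polynomial.degree_eq_natDegree hp.ne_zero, Polynomial.degree_lt_iff_coeff_zero] at *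
    intro n hn
    refine QuaternionAlgebra.ext ?_ ?_ ?_ ?_
    · have := da n hn; rwa [← fa, coeff_coord] at this
    · have := db n hn; rwa [← fb, coeff_coord] at this
    · have := dc n hn; rwa [← fc, coeff_coord] at this
    · have := dd n hn; rwa [← fd, coeff_coord] at this

variable [CharZero K] [NoZeroDivisors ℍ[K,α,β]]

/-- An irreducible polynomial over `K` stays irreducible unless its root field splits the
algebra: a proper factor would have norm associated to `p`, and so be isotropic modulo `p`. -/
theorem irreducible_central (hα : α ≠ 0) (hβ : β ≠ 0) {p : K[X]} (hp : Irreducible p)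
    (h : ¬ SplitsOver α β (AdjoinRoot p)) : Irreducible (central α β p) where
  not_isUnit hu := by
    have := isUnit_normPoly_iff.2 hu
    rw [normPoly_central] at this
    exact hp.not_isUnit ((isUnit_pow_iff two_ne_zero).1 this)
  isUnit_or_isUnit a b hab := by
    have : Fact (Irreducible p) := ⟨hp⟩
    have hN : p ^ 2 = normPoly a * normPoly b := by
      rw [← normPoly_mul, ← hab, normPoly_central]
    obtain ⟨i, hi, hass⟩ := (dvd_prime_pow hp.prime 2).1 (Dvd.intro _ hN.symm)
    rw [← isUnit_normPoly_iff, ← isUnit_normPoly_iff (f := b)]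
    interval_cases i
    · left
      rw [pow_zero] at hass
      exact associated_one_iff_isUnit.1 hass
    · exfalso
      rw [pow_one] at hass
      have hdeg := Polynomial.natDegree_eq_of_degree_eq
        (Polynomial.degree_eq_degree_of_associated hass)
      rw [natDegree_normPoly] at hdeg
      have ha0 : a ≠ 0 := by
        rintro rfl
        rw [normPoly_zero] at hass
        exact hp.ne_zero (associated_zero_iff_eq_zero _ |>.1 hass.symm)
      have hlt : a.degree < p.degree := by
        have := hp.natDegree_pos
        rw [Polynomial.degree_eq_natDegree ha0, Polynomial.degree_eq_natDegree hp.ne_zero]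
        exact_mod_cast (by omega : a.natDegree < p.natDegree)
      refine h (splitsOver_of_qnorm_eq_zero hα hβ (reduce_ne_zero hlt ha0) ?_)
      rw [qnorm_reduce, AdjoinRoot.mk_eq_zero]
      exact hass.symm.dvd
    · right
      obtain ⟨u, hu⟩ := hass.symm
      have : (u : K[X]) * normPoly b = 1 := by
        apply mul_left_cancel₀ (pow_ne_zero 2 hp.ne_zero)
        rw [← mul_assoc, hu, ← hN, mul_one]
      exact IsUnit.of_mul_eq_one_right _ this

end Reduction

/-! ### Factorization over quadratic subfields -/

section Subfields

variable {K : Type*} [Field K] [CharZero K] {α β : K} [NoZeroDivisors ℍ[K,α,β]]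

/-- Let `p` be the minimal polynomial over `K` of a generator `ξ` of `L`, and let `φ` embed a
quadratic subextension `S` of `L` into the algebra. The image `f` under `φ` of the minimal
polynomial of `ξ` over `S` satisfies `p = f * conj f`: the norm of `f` vanishes at `ξ` and has
degree at most that of `p`. -/
theorem exists_eq_mul_conj {S L : Type*} [Field S] [Field L] [Algebra K S] [Algebra K L]
    [Algebra S L] [IsScalarTower K S L] [FiniteDimensional K L] (hS : Module.finrank K S = 2)
    (φ : S →ₐ[K] ℍ[K,α,β]) {p : K[X]} (hp : p.Monic) (hL : Module.finrank K L = p.natDegree)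
    (ξ : L) (hξ : ∀ N : K[X], Polynomial.aeval ξ N = 0 → p ∣ N) :
    ∃ f : ℍ[K,α,β][X], f.Monic ∧ (∀ n, f.coeff n ∈ φ.range) ∧ central α β p = f * conj f := by
  have : FiniteDimensional S L := Module.Finite.of_restrictScalars_finite K S L
  let ψ : S →+* ℍ[K,α,β] := φ
  have hψ : Function.Injective ψ := ψ.injective
  have hint : IsIntegral S ξ := IsIntegral.of_finite S ξ
  set m := minpoly S ξ with hm
  have hmon : m.Monic := minpoly.monic hint
  have hdeg : 2 * m.natDegree ≤ p.natDegree := by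
    rw [← hL, ← Module.finrank_mul_finrank K S L, hS]
    exact Nat.mul_le_mul_left 2 (minpoly.natDegree_le ξ)
  have hfmon : (m.map ψ).Monic := hmon.map ψ
  refine ⟨m.map ψ, hfmon, fun n => ?_, ?_⟩
  · rw [Polynomial.coeff_map]
    exact ⟨m.coeff n, rfl⟩
  -- the image of `φ` is stable under the standard involution
  have hlift : conj (m.map ψ) ∈ Polynomial.lifts ψ := by
    rw [Polynomial.lifts_iff_coeff_lifts]
    intro n
    rw [coeff_conj, Polynomial.coeff_map, star_eq_algebraMap_sub]
    refine ⟨algebraMap K S (2 * (ψ (m.coeff n)).re) - m.coeff n, ?_⟩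
    rw [map_sub]
    congr 1
    exact φ.commutes _
  obtain ⟨m', hm'⟩ := Polynomial.mem_lifts _ |>.1 hlift
  have hNmon := monic_normPoly hfmon
  -- hence `m` divides the norm over `S`, and the norm vanishes at `ξ`
  have hN : (normPoly (m.map ψ)).map (algebraMap K S) = m * m' := by
    apply Polynomial.map_injective ψ hψ
    rw [Polynomial.map_mul, hm', ← central_normPoly, Polynomial.map_map, central]
    congr 1
    exact φ.comp_algebraMap
  have hdvd : p ∣ normPoly (m.map ψ) := by
    apply hξ
    rw [← Polynomial.aeval_map_algebraMap S, hN, map_mul, hm, minpoly.aeval, zero_mul]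
  have heq : normPoly (m.map ψ) = p := by
    refine Polynomial.eq_of_monic_of_dvd_of_natDegree_le hp hNmon hdvd ?_
    rw [natDegree_normPoly, hmon.natDegree_map]
    exact hdeg
  rw [← central_normPoly, heq]

theorem IsQuadraticSubfield.exists_eq_mul_conj {p : K[X]} (hp : p.Monic) (hirr : Irreducible p)
    {S : Subalgebra K (AdjoinRoot p)} (hS : IsQuadraticSubfield S) (h : SplitsOver α β S) :
    ∃ (φ : S →ₐ[K] ℍ[K,α,β]) (f : ℍ[K,α,β][X]), f.Monic ∧ (∀ n, f.coeff n ∈ φ.range) ∧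
      central α β p = f * conj f := by
  have : Fact (Irreducible p) := ⟨hirr⟩
  have : Module.Finite K (AdjoinRoot p) := hp.finite_adjoinRoot
  obtain ⟨F, rfl⟩ : ∃ F : IntermediateField K (AdjoinRoot p), F.toSubalgebra = S :=
    ⟨S.toIntermediateField' hS.1, rfl⟩
  have hF : Module.finrank K F = 2 := hS.2
  obtain ⟨φ⟩ := SplitsOver.nonempty_algHom (S := F) hF h
  refine ⟨φ, QuatFactor.exists_eq_mul_conj (S := F) (L := AdjoinRoot p) hF φ hp ?_
    (AdjoinRoot.root p) ?_⟩
  · rw [(AdjoinRoot.powerBasis hirr.ne_zero).finrank, AdjoinRoot.powerBasis_dim]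
  · intro N hN
    rwa [AdjoinRoot.aeval_eq, AdjoinRoot.mk_eq_zero] at hN

theorem finite_isQuadraticSubfield {p : K[X]} (hp : p.Monic) (hirr : Irreducible p) :
    {S : Subalgebra K (AdjoinRoot p) | IsQuadraticSubfield S}.Finite := by
  have : Fact (Irreducible p) := ⟨hirr⟩
  have : Module.Finite K (AdjoinRoot p) := hp.finite_adjoinRoot
  have : Finite (IntermediateField K (AdjoinRoot p)) :=
    Field.finite_intermediateField_of_exists_primitive_element K _
      (Field.exists_primitive_element K _)
  refine (Set.finite_range
    (IntermediateField.toSubalgebra : IntermediateField K (AdjoinRoot p) → _)).subset ?_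
  intro S hS
  exact ⟨S.toIntermediateField' hS.1, rfl⟩

end Subfields

/-! ### Safe states of transition systems -/

section Safe

/-- A state is safe if every run from it is finite and can only end in a state that satisfies
`good`. -/
inductive Safe {σ : Type*} (step : σ → σ → Prop) (good : σ → Prop) : σ → Prop
  | intro (s : σ) (progress : good s ∨ ∃ t, step s t)
      (next : ∀ t, step s t → Safe step good t) : Safe step good s

variable {σ : Type*} {step : σ → σ → Prop} {good : σ → Prop} {s t : σ}

theorem Safe.progress (h : Safe step good s) : good s ∨ ∃ t, step s t := by
  cases h
  assumption

theorem Safe.good_of_forall_not (h : Safe step good s) (hs : ∀ t, ¬ step s t) : good s :=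
  h.progress.resolve_right fun ⟨t, ht⟩ => hs t ht

theorem Safe.of_good (h : good s) (hs : ∀ t, ¬ step s t) : Safe step good s :=
  .intro s (.inl h) fun t ht => (hs t ht).elim

theorem Safe.of_reflTransGen (h : Safe step good s) (hst : Relation.ReflTransGen step s t) :
    Safe step good t := by
  induction hst with
  | refl => exact h
  | tail _ hbc ih =>
    cases ih with
    | intro _ _ next => exact next _ hbc

theorem Safe.not_exists_infinite_run (h : Safe step good s) :
    ¬ ∃ u : ℕ → σ, u 0 = s ∧ ∀ n, step (u n) (u (n + 1)) := by
  induction h with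
  | intro s _ _ ih =>
    rintro ⟨u, rfl, hu⟩
    exact ih (u 1) (hu 0) ⟨fun n => u (n + 1), rfl, fun n => hu (n + 1)⟩

theorem Safe.exists_good (h : Safe step good s) :
    ∃ t, Relation.ReflTransGen step s t ∧ good t := by
  induction h with
  | intro s progress _ ih =>
    rcases progress with hs | ⟨t, ht⟩
    · exact ⟨s, .refl, hs⟩
    · obtain ⟨v, hv, hgood⟩ := ih t ht
      exact ⟨v, .head ht hv, hgood⟩

end Safe

/-! ### The subfield algorithm -/

section Algorithms

variable {K : Type*} [Field K] {α β : K}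

/-- The acceptable final states of the subfield algorithm. -/
def SubfieldState.Good {p : K[X]} (s : SubfieldState α β p) : Prop :=
  s = .failure ∨ ∃ f, s = .success f (conj f) ∧ f.Monic ∧ central α β p = f * conj f

/-- The correct final states of the algorithm for an irreducible polynomial `p` over `K`. -/
def ScalarState.Good {p : K[X]} (s : ScalarState α β p) : Prop :=
  ∃ l, s = .output l ∧ (∀ q ∈ l, q.Monic ∧ Irreducible q) ∧ l.prod = central α β p

variable [CharZero K] [NoZeroDivisors ℍ[K,α,β]]

theorem safe_subfieldState_loop {p : K[X]} (hp : p.Monic) (hirr : Irreducible p)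
    (todo : List (Subalgebra K (AdjoinRoot p))) (h : ∀ S ∈ todo, IsQuadraticSubfield S) :
    Safe (SubfieldStep α β p) SubfieldState.Good (.loop todo) := by
  induction todo with
  | nil =>
    refine .intro _ (.inr ⟨_, .report⟩) fun t ht => ?_
    cases ht
    exact .of_good (.inl rfl) (by rintro _ ⟨⟩)
  | cons S rest ih =>
    refine .intro _ (.inr ?_) fun t ht => ?_
    · by_cases hS : SplitsOver α β S
      · obtain ⟨φ, f, hf, hc, he⟩ := (h S (by simp)).exists_eq_mul_conj hp hirr hS
        exact ⟨_, .factor S rest hS φ f hf hc he⟩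
      · exact ⟨_, .skip S rest hS⟩
    · cases ht with
      | skip _ _ hS => exact ih fun T hT => h T (by simp [hT])
      | factor _ _ hS φ f hf hc he =>
        exact .of_good (.inr ⟨f, rfl, hf, he⟩) (by rintro _ ⟨⟩)

theorem safe_subfieldState_start {p : K[X]} (hp : p.Monic) (hirr : Irreducible p) :
    Safe (SubfieldStep α β p) SubfieldState.Good .start := by
  refine .intro _ (.inr ?_) fun t ht => ?_
  · have hfin := finite_isQuadraticSubfield hp hirr
    exact ⟨_, .construct hfin.toFinset.toList (Finset.nodup_toList _) (by simp)⟩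
  · cases ht with
    | construct todo hnodup hall =>
      exact safe_subfieldState_loop hp hirr todo fun S hS => (hall S).1 hS

/-! ### The algorithm for irreducible polynomials over the base field -/

theorem safe_scalarState_output_pair {p : K[X]} (hirr : Irreducible p) {f : ℍ[K,α,β][X]}
    (hf : f.Monic) (h : central α β p = f * conj f) :
    Safe (ScalarStep α β p) ScalarState.Good (.output [f, conj f]) := by
  have hN := normPoly_eq_of_central_eq h
  refine .of_good ⟨_, rfl, ?_, by simp [h]⟩ (by rintro _ ⟨⟩)
  simp only [List.mem_cons, List.not_mem_nil, or_false, forall_eq_or_imp, forall_eq]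
  refine ⟨⟨hf, irreducible_of_normPoly (by rwa [hN])⟩, monic_conj hf, irreducible_of_normPoly ?_⟩
  rwa [normPoly_conj, hN]

/-- One step of the improvement loop. The remainder `r` is nonzero, since otherwise `q ^ 2` would
divide `p * q`; then `q' * q = normPoly r` bounds the degree of `q'`. -/
theorem improve_spec {p : K[X]} (hirr : Irreducible p) {f : ℍ[K,α,β][X]} {q : K[X]}
    (hN : normPoly f = p * q) (hq : q.degree < p.degree) (hconst : 0 < q.natDegree)
    {h r : ℍ[K,α,β][X]} (hr : f = h * central α β q + r) (hdeg : r.degree < q.degree)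
    {f' : ℍ[K,α,β][X]} (hf' : f' * central α β q = f * conj r) {q' : K[X]}
    (hq' : normPoly f' = p * q') : q' ≠ 0 ∧ q'.natDegree < q.natDegree := by
  have hq0 : q ≠ 0 := by
    rintro rfl
    simp at hconst
  have hr0 : r ≠ 0 := by
    rintro rfl
    rw [add_zero] at hr
    have hpq : p = q * normPoly h := by
      apply mul_right_cancel₀ hq0
      rw [← hN, hr, normPoly_mul, normPoly_central]
      ring
    rcases hirr.isUnit_or_isUnit hpq with hu | hu
    · exact hconst.ne' (Polynomial.natDegree_eq_zero_of_isUnit hu)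
    · have hass : Associated q p := ⟨hu.unit, by rw [IsUnit.unit_spec, ← hpq]⟩
      exact hq.ne (Polynomial.degree_eq_degree_of_associated hass)
  have hNN : q' * q = normPoly r := by
    have h1 := congrArg normPoly hf'
    rw [normPoly_mul, normPoly_mul, normPoly_conj, normPoly_central, hq', hN] at h1
    apply mul_left_cancel₀ (mul_ne_zero hirr.ne_zero hq0)
    rw [← h1]
    ring
  have hq'0 : q' ≠ 0 := by
    rintro rfl
    rw [zero_mul] at hNN
    exact hr0 (normPoly_eq_zero.1 hNN.symm)
  refine ⟨hq'0, ?_⟩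
  have h2 := congrArg Polynomial.natDegree hNN
  rw [Polynomial.natDegree_mul hq'0 hq0, natDegree_normPoly] at h2
  have h3 := Polynomial.natDegree_lt_natDegree hr0 hdeg
  omega

/-- The improvement step can be executed: if `f = h * q + r`, then `f * conj r` is `q` times
`p - f * conj h`, and `p` divides the norm of this quotient because it does not divide `q`. -/
theorem exists_improve {p : K[X]} (hirr : Irreducible p) {f : ℍ[K,α,β][X]} {q : K[X]}
    (hN : normPoly f = p * q) (hq0 : q ≠ 0) (hq : q.degree < p.degree)
    (hconst : 0 < q.natDegree) : ∃ t, ScalarStep α β p (.loop f q) t := by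
  obtain ⟨h, r, hr, hdeg⟩ := exists_right_division f (central_ne_zero (α := α) (β := β) hq0)
  rw [degree_central] at hdeg
  have hf' : (central α β p - f * conj h) * central α β q = f * conj r := by
    have hc : conj f = central α β q * conj h + conj r := by
      conv_lhs => rw [hr, conj_add, conj_mul, conj_central]
    rw [sub_mul, ← central_mul, ← hN, central_normPoly, mul_assoc, ← central_mul_comm, ← mul_sub,
      hc, add_sub_cancel_left]
  have hdvd : p ∣ normPoly (central α β p - f * conj h) := by
    have h1 := congrArg normPoly hf'
    rw [normPoly_mul, normPoly_mul, normPoly_central, hN, mul_assoc] at h1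
    refine (hirr.prime.dvd_or_dvd (Dvd.intro _ h1.symm)).resolve_right fun h2 => ?_
    exact hq0 (Polynomial.eq_zero_of_dvd_of_degree_lt (hirr.prime.dvd_of_dvd_pow h2) hq)
  obtain ⟨q', hq'⟩ := hdvd
  exact ⟨_, .improve f q hconst h r hr hdeg _ hf' q' (by rw [← hq', central_normPoly])⟩

theorem safe_scalarState_loop {p : K[X]} (hp : p.Monic) (hirr : Irreducible p)
    (f : ℍ[K,α,β][X]) (q : K[X]) (hN : normPoly f = p * q) (hq0 : q ≠ 0)
    (hq : q.degree < p.degree) :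
    Safe (ScalarStep α β p) ScalarState.Good (.loop f q) := by
  induction hn : q.natDegree using Nat.strong_induction_on generalizing f q with
  | _ n ih =>
    refine .intro _ (.inr ?_) fun t ht => ?_
    · rcases Nat.eq_zero_or_pos q.natDegree with h0 | h0
      · exact ⟨_, .finish f q h0⟩
      · exact exists_improve hirr hN hq0 hq h0
    · cases ht with
      | improve _ _ hconst h r hr hdeg f' hf' q' hq' =>
        have hN' := normPoly_eq_of_central_eq hq'
        obtain ⟨hq'0, hlt⟩ := improve_spec hirr hN hq hconst hr hdeg hf' hN'
        exact ih _ (hn ▸ hlt) f' q' hN' hq'0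
          ((Polynomial.degree_lt_degree hlt).trans hq) rfl
      | finish _ _ hconst =>
        have hf0 : f ≠ 0 := by
          rintro rfl
          rw [normPoly_zero] at hN
          exact mul_ne_zero hirr.ne_zero hq0 hN.symm
        have hlc : f.leadingCoeff ≠ 0 := by simpa using hf0
        set g := f * Polynomial.C (Ring.inverse f.leadingCoeff) with hg
        have hmon : g.Monic := by
          rw [Polynomial.Monic, hg, Polynomial.leadingCoeff_mul, Polynomial.leadingCoeff_C,
            mul_ringInverse hlc]
        have hconj : Polynomial.C (Ring.inverse (star f.leadingCoeff)) * conj f = conj g := by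
          rw [hg, conj_mul, conj_C, Ring.inverse_star]
        rw [hconj]
        have hinv : Ring.inverse f.leadingCoeff ≠ 0 := by
          intro h0
          have h1 := mul_ringInverse hlc
          rw [h0, mul_zero] at h1
          exact zero_ne_one h1
        have hNg : normPoly g = p := by
          refine Polynomial.eq_of_monic_of_dvd_of_natDegree_le hp (monic_normPoly hmon)
            ?_ ?_
          · rw [hg, normPoly_mul, hN, mul_assoc]
            exact Dvd.intro _ rfl
          · have h1 := natDegree_normPoly f
            rw [hN, Polynomial.natDegree_mul hirr.ne_zero hq0, hconst, add_zero] at h1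
            rw [natDegree_normPoly, hg, Polynomial.natDegree_mul hf0 (by simpa using hinv),
              Polynomial.natDegree_C, add_zero, h1]
        exact safe_scalarState_output_pair hirr hmon (by rw [← hNg, central_normPoly])

theorem safe_scalarState_subfield {p : K[X]} (hp : p.Monic) (hirr : Irreducible p)
    (h : SplitsOver α β (AdjoinRoot p)) (s : SubfieldState α β p)
    (hs : Safe (SubfieldStep α β p) SubfieldState.Good s) :
    Safe (ScalarStep α β p) ScalarState.Good (.subfield s) := by
  have : Fact (Irreducible p) := ⟨hirr⟩
  induction hs with
  | intro s progress next ih =>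
    refine .intro _ (.inr ?_) fun t ht => ?_
    · rcases progress with (rfl | ⟨f, rfl, -⟩) | ⟨t, ht⟩
      · obtain ⟨a, ha, haa⟩ := h.exists_mul_self_eq_zero
        have hza : IsZeroDivisor a := ⟨ha, a, ha, .inl haa⟩
        obtain ⟨f, hf, hdeg⟩ := exists_reduce_eq hp a
        have hdvd : p ∣ normPoly f := by
          rw [← AdjoinRoot.mk_eq_zero, ← qnorm_reduce, hf]
          exact hza.qnorm_eq_zero
        obtain ⟨q, hq⟩ := hdvd
        exact ⟨_, .zeroDivisor a hza f hf hdeg q (by rw [← hq, central_normPoly])⟩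
      · exact ⟨_, .subfieldSuccess f (conj f)⟩
      · exact ⟨_, .inSubfield s t ht⟩
    · cases ht with
      | inSubfield _ t ht => exact ih t ht
      | subfieldSuccess f g =>
        rcases progress with (h0 | ⟨f', h0, hf, he⟩) | ⟨t, ⟨⟩⟩
        · cases h0
        · cases h0
          exact safe_scalarState_output_pair hirr hf he
      | zeroDivisor a ha f hf hdeg q hq =>
        have hN := normPoly_eq_of_central_eq hq
        have hf0 : f ≠ 0 := by
          rintro rfl
          apply ha.1
          rw [← hf]
          ext <;> simp [reduce]
        have hq0 : q ≠ 0 := by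
          rintro rfl
          rw [mul_zero] at hN
          exact hf0 (normPoly_eq_zero.1 hN)
        refine safe_scalarState_loop hp hirr f q hN hq0 (Polynomial.degree_lt_degree ?_)
        have h1 := natDegree_normPoly f
        rw [hN, Polynomial.natDegree_mul hirr.ne_zero hq0] at h1
        have h2 := Polynomial.natDegree_lt_natDegree hf0 hdeg
        omega

theorem safe_scalarState_start (hα : α ≠ 0) (hβ : β ≠ 0) {p : K[X]} (hp : p.Monic)
    (hirr : Irreducible p) : Safe (ScalarStep α β p) ScalarState.Good .start := by
  refine .intro _ (.inr ?_) fun t ht => ?_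
  · by_cases h : SplitsOver α β (AdjoinRoot p)
    · exact ⟨_, .callSubfield h⟩
    · exact ⟨_, .quickExit h⟩
  · cases ht with
    | quickExit h =>
      refine .of_good ⟨_, rfl, ?_, by simp⟩ (by rintro _ ⟨⟩)
      simp only [List.mem_singleton, forall_eq]
      exact ⟨monic_central.2 hp, irreducible_central hα hβ hirr h⟩
    | callSubfield h =>
      exact safe_scalarState_subfield hp hirr h _ (safe_subfieldState_start hp hirr)

end Algorithms

/-! ### The complete factorization algorithm -/

section CompleteFactorization

variable {K : Type*} [Field K] {α β : K}

/-- The correct final states of the complete factorization algorithm for the input `f`. -/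
def State.Good (f : ℍ[K,α,β][X]) (s : State α β) : Prop :=
  ∃ c L, s = .output c L ∧ IsCompleteFactorization f c L

/-- A run of the algorithm for irreducible polynomials over `K` is embedded in the run of the
complete factorization algorithm that calls it. -/
theorem safe_state_call {f q : ℍ[K,α,β][X]} (c : ℍ[K,α,β]) (L : List ℍ[K,α,β][X]) (r : K[X])
    (e : ℕ) (todo : List (K[X] × ℕ))
    (hnext : ∀ l : List ℍ[K,α,β][X], (∀ g ∈ l, g.Monic ∧ Irreducible g) →
      l.prod = central α β r → Safe (Step α β) (State.Good f)
        (.centralLoop c (L ++ (List.replicate e l).flatten) q todo))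
    (s : ScalarState α β r) (hs : Safe (ScalarStep α β r) ScalarState.Good s) :
    Safe (Step α β) (State.Good f) (.call c L q r e todo s) := by
  induction hs with
  | intro s progress next ih =>
    refine .intro _ (.inr ?_) fun t ht => ?_
    · rcases progress with ⟨l, rfl, -⟩ | ⟨t, ht⟩
      · exact ⟨_, .endCall c L q r e todo l⟩
      · exact ⟨_, .inCall c L q r e todo s t ht⟩
    · cases ht with
      | inCall _ _ _ _ _ _ _ t ht => exact ih t ht
      | endCall _ _ _ _ _ _ l =>
        rcases progress with ⟨l', h0, hl, hprod⟩ | ⟨t, ⟨⟩⟩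
        cases h0
        exact hnext l hl hprod

variable [CharZero K] [NoZeroDivisors ℍ[K,α,β]]

/-- Splitting off the greatest common right divisor with the last irreducible factor of the norm
leaves a monic primitive polynomial of smaller degree, the factorization of whose norm is known. -/
theorem peelOff_spec {q : ℍ[K,α,β][X]} (hq : q.Monic) (hprim : IsPrimitive q)
    {F : List (K[X] × ℕ)} {g : K[X]} {e : ℕ}
    (hF : IsFactorization (normPoly q) (F ++ [(g, e + 1)])) {r : ℍ[K,α,β][X]}
    (hr : IsGcrd q (central α β g) r) {q' : ℍ[K,α,β][X]} (hq' : q = q' * r) :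
    Irreducible r ∧ q'.Monic ∧ IsPrimitive q' ∧ q'.natDegree < q.natDegree ∧
      IsFactorization (normPoly q') (if e = 0 then F else F ++ [(g, e)]) := by
  obtain ⟨hnodup, hirr, hprod⟩ := hF
  obtain ⟨hgmon, hgirr, -⟩ := hirr (g, e + 1) (by simp)
  have hNq : (F.map fun t => t.1 ^ t.2).prod * g ^ (e + 1) = normPoly q := by
    simpa using hprod
  have hNr : normPoly r = g := by
    refine hr.normPoly_eq hq.ne_zero hprim hgmon hgirr ?_
    rw [← hNq, pow_succ, ← mul_assoc]
    exact Dvd.intro_left _ rfl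
  have hq'mon : q'.Monic := by
    have h1 := hq.leadingCoeff
    rwa [hq', Polynomial.leadingCoeff_mul, hr.1.leadingCoeff, mul_one] at h1
  have hNq' : (F.map fun t => t.1 ^ t.2).prod * g ^ e = normPoly q' := by
    apply mul_right_cancel₀ hgirr.ne_zero
    rw [mul_assoc, ← pow_succ, hNq, hq', normPoly_mul, hNr]
  refine ⟨irreducible_of_normPoly (hNr.symm ▸ hgirr), hq'mon, ?_, ?_, ?_⟩
  · rintro c ⟨h, rfl⟩
    refine hprim c ⟨h * r, ?_⟩
    rw [hq', mul_assoc, mul_assoc, central_mul_comm]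
  · have h1 := natDegree_normPoly r
    rw [hNr] at h1
    have h2 : 0 < g.natDegree := hgirr.natDegree_pos
    rw [hq', Polynomial.natDegree_mul hq'mon.ne_zero hr.1.ne_zero]
    omega
  · split_ifs with he
    · subst he
      refine ⟨?_, fun t ht => hirr t (by simp [ht]), by simpa using hNq'⟩
      rw [List.map_append] at hnodup
      exact hnodup.of_append_left
    · refine ⟨by simpa using hnodup, fun t ht => ?_, by simpa using hNq'⟩
      rcases List.mem_append.1 ht with ht | ht
      · exact hirr t (by simp [ht])
      · rw [List.mem_singleton.1 ht]
        exact ⟨hgmon, hgirr, Nat.pos_of_ne_zero he⟩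

theorem safe_state_peel {f : ℍ[K,α,β][X]} (L : List ℍ[K,α,β][X]) (q : ℍ[K,α,β][X])
    (F : List (K[X] × ℕ)) (hq : q.Monic) (hprim : IsPrimitive q)
    (hF : IsFactorization (normPoly q) F) (hL : ∀ g ∈ L, g.Monic ∧ Irreducible g)
    (hf : f = Polynomial.C f.leadingCoeff * (q * L.prod)) :
    Safe (Step α β) (State.Good f) (.peel f.leadingCoeff L q F) := by
  induction hn : q.natDegree using Nat.strong_induction_on generalizing L q F with
  | _ n ih =>
    refine .intro _ (.inr ?_) fun t ht => ?_
    · rcases Nat.eq_zero_or_pos q.natDegree with h0 | h0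
      · exact ⟨_, .finish _ L q h0 F⟩
      · rcases List.eq_nil_or_concat F with rfl | ⟨F, ⟨g, e⟩, rfl⟩
        · exfalso
          have h1 := natDegree_normPoly q
          rw [← hF.2.2] at h1
          simp at h1
          omega
        · rw [List.concat_eq_append] at hF ⊢
          obtain ⟨e, rfl⟩ := Nat.exists_eq_succ_of_ne_zero (hF.2.1 (g, e) (by simp)).2.2.ne'
          obtain ⟨r, hr, -⟩ := exists_isGcrd (g := central α β g) hq.ne_zero
          obtain ⟨q', hq'⟩ := hr.2.1
          exact ⟨_, .peelOff _ L q h0 F g e r hr q' hq'⟩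
    · cases ht with
      | peelOff _ _ _ hconst F g e r hr q' hq' =>
        obtain ⟨hrirr, hq'mon, hprim', hlt, hF'⟩ := peelOff_spec hq hprim hF hr hq'
        refine ih _ (hn ▸ hlt) (r :: L) q' _ hq'mon hprim' hF' ?_ ?_ rfl
        · simp only [List.mem_cons, forall_eq_or_imp]
          exact ⟨⟨hr.1, hrirr⟩, hL⟩
        · rw [List.prod_cons, ← mul_assoc q', ← hq']
          exact hf
      | finish _ _ _ hconst =>
        refine .of_good ⟨_, L, rfl, rfl, hL, ?_⟩ (by rintro _ ⟨⟩)
        rwa [hq.natDegree_eq_zero.1 hconst, one_mul] at hf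

theorem safe_state_centralLoop {f : ℍ[K,α,β][X]} (hα : α ≠ 0) (hβ : β ≠ 0)
    {q : ℍ[K,α,β][X]} (hq : q.Monic) (hprim : IsPrimitive q) (todo : List (K[X] × ℕ))
    (htodo : ∀ t ∈ todo, t.1.Monic ∧ Irreducible t.1)
    (L : List ℍ[K,α,β][X]) (hL : ∀ g ∈ L, g.Monic ∧ Irreducible g)
    (hf : f = Polynomial.C f.leadingCoeff *
      (q * (L.prod * central α β (todo.map fun t => t.1 ^ t.2).prod))) :
    Safe (Step α β) (State.Good f) (.centralLoop f.leadingCoeff L q todo) := by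
  induction todo generalizing L with
  | nil =>
    refine .intro _ (.inr ?_) fun t ht => ?_
    · obtain ⟨F, hF⟩ := exists_isFactorization (monic_normPoly hq)
      exact ⟨_, .factorNorm _ L q _ (central_normPoly q) F hF⟩
    · cases ht with
      | factorNorm _ _ _ N hN F hF =>
        rw [← normPoly_eq_of_central_eq hN] at hF
        exact safe_state_peel L q F hq hprim hF hL (by simpa using hf)
  | cons t todo ih =>
    obtain ⟨r, e⟩ := t
    refine .intro _ (.inr ⟨_, .startCall _ L q r e todo⟩) fun t ht => ?_
    cases ht
    obtain ⟨hr, hirr⟩ := htodo (r, e) (by simp)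
    refine safe_state_call _ L r e todo (fun l hl hprod => ?_) _
      (safe_scalarState_start hα hβ hr hirr)
    refine ih (fun t ht => htodo t (by simp [ht])) _ ?_ ?_
    · intro g hg
      rcases List.mem_append.1 hg with hg | hg
      · exact hL g hg
      · obtain ⟨l', hl', hgl⟩ := List.mem_flatten.1 hg
        rw [List.eq_of_mem_replicate hl'] at hgl
        exact hl g hgl
    · have hpow : (List.replicate e l).flatten.prod = central α β (r ^ e) := by
        rw [List.prod_flatten, List.map_replicate, List.prod_replicate, hprod, central_pow]
      rw [List.prod_append, hpow, mul_assoc L.prod, ← central_mul]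
      simpa using hf

theorem safe_state_start (hα : α ≠ 0) (hβ : β ≠ 0) {f : ℍ[K,α,β][X]} (hf : f ≠ 0) :
    Safe (Step α β) (State.Good f) (.start f) := by
  refine .intro _ (.inr ⟨_, .leadingCoeff f⟩) fun t ht => ?_
  cases ht
  have hlc : f.leadingCoeff ≠ 0 := by simpa using hf
  set m := Polynomial.C (Ring.inverse f.leadingCoeff) * f with hm
  have hmon : m.Monic := by
    rw [Polynomial.Monic, hm, Polynomial.leadingCoeff_mul, Polynomial.leadingCoeff_C,
      ringInverse_mul hlc]
  have hfm : f = Polynomial.C f.leadingCoeff * m := by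
    rw [hm, ← mul_assoc, ← Polynomial.C_mul, mul_ringInverse hlc, Polynomial.C_1, one_mul]
  have hcoords : ∃ h ∈ coords m, h ≠ 0 := by
    by_contra! h0
    obtain ⟨g, hg⟩ := forall_coords_dvd_iff.1 fun h hh => zero_dvd_iff.2 (h0 h hh)
    exact hmon.ne_zero (by simpa [central] using hg)
  refine .intro _ (.inr ?_) fun t ht => ?_
  · obtain ⟨p, hp⟩ := exists_isMonicGcd hcoords
    obtain ⟨q, hq⟩ := forall_coords_dvd_iff.1 hp.2.1
    exact ⟨_, .splitCentral _ [] m p hp q hq⟩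
  cases ht with
  | splitCentral _ _ _ p hp q hq =>
  have hqmon : q.Monic := by
    have h1 := hmon.leadingCoeff
    rwa [hq, Polynomial.leadingCoeff_mul, (monic_central.2 hp.1).leadingCoeff, mul_one] at h1
  have hprim : IsPrimitive q := by
    rintro e ⟨h, rfl⟩
    have hdvd : e * p ∣ p := hp.2.2 _ (forall_coords_dvd_iff.2 ⟨h, by
      rw [hq, mul_assoc, central_mul]⟩)
    obtain ⟨u, hu⟩ := hdvd
    refine IsUnit.of_mul_eq_one u (mul_right_cancel₀ hp.1.ne_zero ?_)
    rw [one_mul]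
    conv_rhs => rw [hu]
    ring
  refine .intro _ (.inr ?_) fun t ht => ?_
  · obtain ⟨l, hl⟩ := exists_isFactorization hp.1
    exact ⟨_, .factorCentral _ [] q p l hl⟩
  cases ht with
  | factorCentral _ _ _ _ todo htodo =>
  refine safe_state_centralLoop hα hβ hqmon hprim todo
    (fun t ht => ⟨(htodo.2.1 t ht).1, (htodo.2.1 t ht).2.1⟩) [] (by simp) ?_
  rw [htodo.2.2, List.prod_nil, one_mul, ← hq]
  exact hfm

end CompleteFactorization

end QuatFactor
theorem mainTheorem1 {K : Type*} [Field K] [NumberField K] (α β : K)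
    (hα : α ≠ 0) (hβ : β ≠ 0) (hdiv : QuatFactor.IsDivision ℍ[K,α,β])
    (f : ℍ[K,α,β][X]) (hf : f ≠ 0) :
    -- a complete factorization exists
    (∃ L : List ℍ[K,α,β][X], QuatFactor.IsCompleteFactorization f f.leadingCoeff L) ∧
    -- every run of the algorithm is finite
    (¬ ∃ s : ℕ → QuatFactor.State α β,
      s 0 = .start f ∧ ∀ n, QuatFactor.Step α β (s n) (s (n + 1))) ∧
    -- no run is ever blocked before it has produced an output
    (∀ s : QuatFactor.State α β, QuatFactor.Reachable f s →
      (∃ c L, s = .output c L) ∨ ∃ t, QuatFactor.Step α β s t) ∧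
    -- some run produces an output
    (∃ c L, QuatFactor.Reachable f (.output c L)) ∧
    -- whatever is output is a complete factorization
    (∀ c L, QuatFactor.Reachable f (.output c L) →
      QuatFactor.IsCompleteFactorization f c L) := by
  have := hdiv.noZeroDivisors
  have hsafe := QuatFactor.safe_state_start hα hβ hf
  have hout : ∃ c L, QuatFactor.Reachable f (.output c L) ∧
      QuatFactor.IsCompleteFactorization f c L := by
    obtain ⟨_, hs, c, L, rfl, hL⟩ := hsafe.exists_good
    exact ⟨c, L, hs, hL⟩
  obtain ⟨c, L, hreach, hL⟩ := hout
  refine ⟨⟨L, hL.1 ▸ hL⟩, hsafe.not_exists_infinite_run, fun s hs => ?_, ⟨c, L, hreach⟩,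
    fun c L hs => ?_⟩
  · rcases (hsafe.of_reflTransGen hs).progress with ⟨c, L, h, -⟩ | h
    · exact .inl ⟨c, L, h⟩
    · exact .inr h
  · obtain ⟨c', L', h, hL⟩ := (hsafe.of_reflTransGen hs).good_of_forall_not (by rintro _ ⟨⟩)
    cases h
    exact hL
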